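/- Let $\nu>0$. There is $k_0>0$, depending only on $\nu$, such that the following holds. Let $L,T>0$, let $D=[0,L]$, and let $L^2(D)$ be the space of $L$-periodic, locally square-integrable functions with vanishing mean, with norm $\|\cdot\|_{L^2}$ and inner product $(\cdot,\cdot)$ over one period. Let $B:L^2(D)\to L^2(D)$ be Lipschitz, $\|B(v)-B(w)\|_{L^2}\le C_B\|v-w\|_{L^2}$, and let $c_B\ge\max\{C_B,\|B(0)\|_{L^2}\}$. Let $W$ be a real Wiener process with respect to a filtration $(\mathcal F_t)_{t\ge0}$ on a probability space $(\Omega,\mathcal F,\mathbb P)$, and let $u_0$ be an $L^2(D)$-valued random variable. Let $0=x_0<\dots<x_N=L$ be a partition of $D$ and let $r\ge4$ be an integer. Let $V_h$ be the space of $L$-periodic functions with vanishing mean that are of class $C^{r-3}$ and are polynomials of degree at most $r-1$ on each $[x_{i-1},x_i]$. Let $M\ge1$ be an integer, $k=T/M$ and $t_n=nk$. Let $u_h^n$, $0\le n\le M$, be $V_h$-valued and $\mathcal F_{t_n}$-measurable random variables such that $u_h^0=P_hu_0$, where $P_h$ is the $L^2$-orthogonal projection onto $V_h$, and such that almost surely,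 for all $0\le n<M$ and all $\phi\in V_h$, $$(u_h^{n+1}-u_h^n,\phi)+\nu k(\partial_x^2u_h^{n+1},\partial_x^2\phi)-k(\partial_xu_h^{n+1},\partial_x\phi)+k(u_h^{n+1}\partial_xu_h^{n+1},\phi)=\bigl(B(u_h^n)(W(t_{n+1})-W(t_n)),\phi\bigr).$$ Assume that $k\le k_0$. (i) If $u_0\in L^2(\Omega;L^2(D))$, then $$\mathbb E\Bigl[\sup_{1\le n\le M}\|u_h^n\|_{L^2}^2\Bigr]+k\sum_{n=1}^M\mathbb E\bigl[\|\partial_x^2u_h^n\|_{L^2}^2\bigr]\le C_1,$$ where $C_1$ depends only on $\nu$, $T$, $c_B$ and an upper bound for the norm of $u_0$ in $L^2(\Omega;L^2(D))$. (ii) For every real $p$ with $0\le p\le3$, if $u_0\in L^{2^p}(\Omega;L^2(D))$, then $$\mathbb E\Bigl[\sup_{1\le n\le M}\|u_h^n\|_{L^2}^{2^p}\Bigr]\le C_p,$$ where $C_p$ depends only on $p$, $\nu$, $T$, $c_B$ and an upper bound for the norm of $u_0$ in $L^{2^p}(\Omega;L^2(D))$. In particular the constants do not depend on the partition, on $r$,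 on $M$ or on the realization of the scheme. -/

import Mathlib

open MeasureTheory ProbabilityTheory
open scoped NNReal ENNReal

noncomputable section

namespace SKS

/-- Lebesgue measure on one period `D = (0, L]`. -/
abbrev dx (L : ℝ) : Measure ℝ := volume.restrict (Set.Ioc 0 L)

/-- `L²(D)`: (classes of) square-integrable functions on one period with vanishing mean,
with the norm and inner product of `L²(0, L)`. -/
def L2D (L : ℝ) : Submodule ℝ (Lp ℝ 2 (dx L)) where
  carrier := {v | ∫ x, v x ∂(dx L) = 0}
  zero_mem' := by
    have h : ∫ x, (0 : Lp ℝ 2 (dx L)) x ∂(dx L) = ∫ _x, (0 : ℝ) ∂(dx L) :=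
      integral_congr_ae (Lp.coeFn_zero ℝ 2 (dx L))
    simpa using h
  add_mem' := by
    intro v w hv hw
    have h : ∫ x, (v + w) x ∂(dx L) = ∫ x, (v x + w x) ∂(dx L) :=
      integral_congr_ae (Lp.coeFn_add v w)
    have hvi : Integrable v (dx L) := (Lp.memLp v).integrable (by norm_num)
    have hwi : Integrable w (dx L) := (Lp.memLp w).integrable (by norm_num)
    rw [integral_add hvi hwi] at h
    simp only [Set.mem_ofPred_eq] at hv hw ⊢
    rw [h, hv, hw, add_zero]
  smul_mem' := by
    intro c v hv
    have h : ∫ x, (c • v) x ∂(dx L) = ∫ x, c * v x ∂(dx L) :=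
      integral_congr_ae (Lp.coeFn_smul c v)
    simp only [Set.mem_ofPred_eq] at hv ⊢
    rw [h, integral_const_mul, hv, mul_zero]

/-- The inner product `(f, g) = ∫_D f g dx`. -/
def ip (L : ℝ) (f g : ℝ → ℝ) : ℝ := ∫ x, f x * g x ∂(dx L)

/-- The norm `‖f‖_{L²(D)}`, as an extended nonnegative number. -/
def nrm (L : ℝ) (f : ℝ → ℝ) : ℝ≥0∞ := eLpNorm f 2 (dx L)

/-- A partition `0 = x_0 < x_1 < ⋯ < x_N = L` of the domain. -/
structure Mesh (L : ℝ) where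
  N : ℕ
  node : Fin (N + 1) → ℝ
  strictMono : StrictMono node
  node_zero : node 0 = 0
  node_last : node (Fin.last N) = L

/-- The finite element space `V_h`: `L`-periodic functions of class `C^{r-3}` that are polynomials
of degree at most `r - 1` on every cell `[x_{i-1}, x_i]`. As for all the function spaces
used, the elements have vanishing mean. -/
def Vh {L : ℝ} (mesh : Mesh L) (r : ℕ) : Submodule ℝ (ℝ → ℝ) where
  carrier := {f | Function.Periodic f L ∧ ContDiff ℝ ((r - 3 : ℕ) : WithTop ℕ∞) f ∧
    (∀ i : Fin mesh.N, ∃ q : Polynomial ℝ, q.natDegree ≤ r - 1 ∧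
      ∀ x ∈ Set.Icc (mesh.node i.castSucc) (mesh.node i.succ), f x = q.eval x) ∧
    ∫ x, f x ∂(dx L) = 0}
  zero_mem' := by
    refine ⟨fun x => rfl, contDiff_const, fun i => ⟨0, by simp, by simp⟩, by simp⟩
  add_mem' := by
    rintro f g ⟨hf1, hf2, hf3, hf4⟩ ⟨hg1, hg2, hg3, hg4⟩
    refine ⟨hf1.add hg1, hf2.add hg2, fun i => ?_, ?_⟩
    · obtain ⟨p, hp, hp'⟩ := hf3 i
      obtain ⟨q, hq, hq'⟩ := hg3 i
      refine ⟨p + q, (Polynomial.natDegree_add_le p q).trans (max_le hp hq), fun x hx => ?_⟩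
      rw [Pi.add_apply, hp' x hx, hq' x hx, Polynomial.eval_add]
    · have hfi : Integrable f (dx L) :=
        (hf2.continuous.integrableOn_Icc (a := 0) (b := L)).mono_set Set.Ioc_subset_Icc_self
      have hgi : Integrable g (dx L) :=
        (hg2.continuous.integrableOn_Icc (a := 0) (b := L)).mono_set Set.Ioc_subset_Icc_self
      simp only [Pi.add_apply]
      rw [integral_add hfi hgi, hf4, hg4, add_zero]
  smul_mem' := by
    rintro c f ⟨hf1, hf2, hf3, hf4⟩
    refine ⟨fun x => by simp [hf1 x], hf2.const_smul c, fun i => ?_, ?_⟩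
    · obtain ⟨p, hp, hp'⟩ := hf3 i
      refine ⟨c • p, (Polynomial.natDegree_smul_le c p).trans hp, fun x hx => ?_⟩
      rw [Pi.smul_apply, hp' x hx, Polynomial.eval_smul]
    · simp only [Pi.smul_apply, smul_eq_mul]
      rw [integral_const_mul, hf4, mul_zero]

theorem Vh_memLp {L : ℝ} {mesh : Mesh L} {r : ℕ} (v : Vh mesh r) :
    MemLp (v : ℝ → ℝ) 2 (dx L) := by
  have hc : Continuous (v : ℝ → ℝ) := v.2.2.1.continuous
  obtain ⟨C, hC⟩ := isCompact_Icc.exists_bound_of_continuousOn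
    (hc.continuousOn (s := Set.Icc 0 L))
  refine MemLp.of_bound hc.aestronglyMeasurable C ?_
  filter_upwards [ae_restrict_mem measurableSet_Ioc] with x hx
  exact hC x (Set.Ioc_subset_Icc_self hx)

/-- The element of `L²(D)` given by a finite element function. -/
def toL2 {L : ℝ} {mesh : Mesh L} {r : ℕ} (v : Vh mesh r) : L2D L :=
  ⟨(Vh_memLp v).toLp (v : ℝ → ℝ), by
    have h : ∫ x, ((Vh_memLp v).toLp (v : ℝ → ℝ)) x ∂(dx L) = ∫ x, (v : ℝ → ℝ) x ∂(dx L) :=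
      integral_congr_ae (MemLp.coeFn_toLp (Vh_memLp v))
    exact h.trans v.2.2.2.2⟩

/-- `W` is a real Wiener process relative to the filtration `ℱ`. -/
structure IsWienerProcess {Ω : Type*} {mΩ : MeasurableSpace Ω} (P : Measure Ω)
    (ℱ : Filtration ℝ≥0 mΩ) (W : ℝ≥0 → Ω → ℝ) : Prop where
  brownian : IsBrownianReal W P
  adapted : StronglyAdapted ℱ W
  indep : ∀ s t : ℝ≥0, s ≤ t →
    Indep (MeasurableSpace.comap (fun ω => W t ω - W s ω) inferInstance) (ℱ s) P

/-- `u` is a solution of the fully discrete scheme with `M` time steps of size `k = T / M` and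
`t_n = n k`: the random variable `u n` takes its values in `V_h` and is `ℱ_{t_n}`-measurable,
`u 0` is the `L²`-projection of `u₀` onto `V_h`, and almost surely, for all `n < M` and all
`φ` in `V_h`, with `v = u (n + 1)`,
`(v - u n, φ) + ν k (∂²v, ∂²φ) - k (∂v, ∂φ) + k (v ∂v, φ) = (B (u n) (W t_{n+1} - W t_n), φ)`.
Second derivatives are taken cell by cell (the finitely many nodes are a null set). -/
structure IsDiscreteSolution {Ω : Type*} {mΩ : MeasurableSpace Ω} (P : Measure Ω)
    (ℱ : Filtration ℝ≥0 mΩ) (W : ℝ≥0 → Ω → ℝ) {L : ℝ} (ν : ℝ) (B : L2D L → L2D L)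
    (u₀ : Ω → L2D L) (T : ℝ≥0) (M : ℕ) {mesh : Mesh L} {r : ℕ}
    (u : ℕ → Ω → Vh mesh r) : Prop where
  adapted : ∀ n ≤ M, StronglyMeasurable[ℱ (n * (T / M))] (fun ω => toL2 (u n ω))
  initial : ∀ᵐ ω ∂P, ∀ φ : Vh mesh r,
    ip L (fun x => (u₀ ω : Lp ℝ 2 (dx L)) x - (u 0 ω : ℝ → ℝ) x) φ = 0
  step : ∀ᵐ ω ∂P, ∀ n < M, ∀ φ : Vh mesh r,
    ip L (fun x => (u (n + 1) ω : ℝ → ℝ) x - (u n ω : ℝ → ℝ) x) φ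
      + ν * (T / M : ℝ) *
          ip L (deriv (deriv (u (n + 1) ω : ℝ → ℝ))) (deriv (deriv (φ : ℝ → ℝ)))
      - (T / M : ℝ) * ip L (deriv (u (n + 1) ω : ℝ → ℝ)) (deriv (φ : ℝ → ℝ))
      + (T / M : ℝ) *
          ip L (fun x => (u (n + 1) ω : ℝ → ℝ) x * deriv (u (n + 1) ω : ℝ → ℝ) x) φ
    = ip L (fun x => (B (toL2 (u n ω)) : Lp ℝ 2 (dx L)) x *
          (W ((n + 1 : ℕ) * (T / M)) ω - W (n * (T / M)) ω)) φ

/-- `B` is Lipschitz on `L²(D)` with constant `C_B`, and `max {C_B, ‖B(0)‖} ≤ c_B`. -/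
def LipschitzNoise {L : ℝ} (B : L2D L → L2D L) (cB : ℝ) : Prop :=
  ∃ CB : ℝ, (∀ v w : L2D L, ‖B v - B w‖ ≤ CB * ‖v - w‖) ∧ max CB ‖B 0‖ ≤ cB

end SKS

end

namespace SKS

/-! ### Finite element functions and the one-step energy inequality -/

section FiniteElements

/-! Testing the scheme with φ = u^{n+1} removes the nonlinearity, since v²v' is the derivative of
v³/3 and v is periodic. The anti-diffusion is absorbed by integrating by parts and applying Young's
inequality: ‖v'‖² = -(v, v'') ≤ ν/2 ‖v''‖² + ‖v‖²/(2ν). In the noise term, u^{n+1} is split as u^n +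
d, and the part containing d is absorbed by the ‖d‖² that implicit Euler provides. The result is
`energy_step`, in which the increment ξ of W multiplies only 𝓕_{t_n}-measurable quantities.
Everything probabilistic uses this inequality alone, abstracted as `IsEnergyScheme`.

Let ρ_n = (1 + ‖u^n‖²)/(1 + ‖u^0‖²). Up to the factor (1 - k/ν)⁻¹, one step multiplies ρ_n by at
most 1 + 2γξ + βξ², with γ known at time t_n and γ² ≤ β. In the fifth power the term linear in ξ has
mean zero and the rest is O(k) in mean, so ρ^5 grows on average by at most a factor exp(Ck) per
step, even against any nonnegative weight known at time t_n (`lintegral_ratio_step`).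

Stopping at a level turns this into a weak-type bound for max ρ^5 (`maximal_inequality`). Summing
over dyadic levels gives a strong bound for max ρ^4, because the spare power makes the series
geometric (`lintegral_sup_pow_four_le`). Neither conditional expectations nor a
Burkholder-Davis-Gundy inequality is needed. Dividing by the initial energy and then using (1 +
‖u^0‖²)^{q/2} as weight makes the q-th moment of u₀ sufficient for every q ≤ 8; this covers q = 2^p
with p ≤ 3.

For the dissipation, the energy inequality is integrated and telescoped, with second moments taken
from the maximal bound (`sum_dissipation_le`). -/

theorem Mesh.exists_cell {L : ℝ} (mesh : Mesh L) {x : ℝ} (hx0 : 0 ≤ x) (hxL : x < L) :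
    ∃ i : Fin mesh.N, x ∈ Set.Ico (mesh.node i.castSucc) (mesh.node i.succ) := by
  have key : ∀ j : Fin (mesh.N + 1), x < mesh.node j →
      ∃ i : Fin mesh.N, x ∈ Set.Ico (mesh.node i.castSucc) (mesh.node i.succ) := by
    intro j
    induction j using Fin.induction with
    | zero => intro h; rw [mesh.node_zero] at h; linarith
    | succ j ih =>
      intro h
      by_cases h' : x < mesh.node j.castSucc
      · exact ih h'
      · exact ⟨j, not_lt.mp h', h⟩
  exact key (Fin.last _) (by rwa [mesh.node_last])

theorem Mesh.exists_open_cell {L : ℝ} (mesh : Mesh L) {x : ℝ} (hx : x ∈ Set.Icc 0 L)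
    (hn : x ∉ Set.range mesh.node) :
    ∃ i : Fin mesh.N, x ∈ Set.Ioo (mesh.node i.castSucc) (mesh.node i.succ) := by
  have hxL : x ≠ L := fun h => hn ⟨Fin.last _, by rw [mesh.node_last, h]⟩
  obtain ⟨i, hi⟩ := mesh.exists_cell hx.1 (lt_of_le_of_ne hx.2 hxL)
  exact ⟨i, lt_of_le_of_ne hi.1 fun h => hn ⟨_, h⟩, hi.2⟩

variable {L : ℝ} {mesh : Mesh L} {r : ℕ}

theorem Vh_contDiff_one (hr : 4 ≤ r) (v : Vh mesh r) : ContDiff ℝ 1 (v : ℝ → ℝ) :=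
  v.2.2.1.of_le (by exact_mod_cast (by omega : 1 ≤ r - 3))

theorem Vh_hasDerivAt (hr : 4 ≤ r) (v : Vh mesh r) (x : ℝ) :
    HasDerivAt (v : ℝ → ℝ) (deriv (v : ℝ → ℝ) x) x :=
  ((Vh_contDiff_one hr v).differentiable (by norm_num) x).hasDerivAt

theorem Vh_continuous_deriv (hr : 4 ≤ r) (v : Vh mesh r) : Continuous (deriv (v : ℝ → ℝ)) :=
  (Vh_contDiff_one hr v).continuous_deriv (by norm_num)

theorem Vh_apply_period (v : Vh mesh r) : (v : ℝ → ℝ) L = (v : ℝ → ℝ) 0 := by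
  simpa using v.2.1 0

theorem Vh_deriv_apply_period (v : Vh mesh r) :
    deriv (v : ℝ → ℝ) L = deriv (v : ℝ → ℝ) 0 := by
  have h : (fun x => (v : ℝ → ℝ) (x + L)) = v := funext v.2.1
  have h2 := deriv_comp_add_const (v : ℝ → ℝ) L 0
  rw [h, zero_add] at h2
  exact h2.symm

/-- Off the nodes, the derivative of a finite element function is differentiable, with locally
uniform bounds on every period. -/
theorem Vh_second_deriv (v : Vh mesh r) : ∃ C : ℝ, ∀ x ∈ Set.Icc 0 L \ Set.range mesh.node,
    DifferentiableAt ℝ (deriv (v : ℝ → ℝ)) x ∧ ‖deriv (deriv (v : ℝ → ℝ)) x‖ ≤ C := by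
  choose q _ hq using v.2.2.2.1
  have hb : ∀ i, ∃ C, ∀ x ∈ Set.Icc 0 L, ‖(q i).derivative.derivative.eval x‖ ≤ C := fun i =>
    isCompact_Icc.exists_bound_of_continuousOn (q i).derivative.derivative.continuous.continuousOn
  choose C hC using hb
  -- Each C i bounds its polynomial on the whole period, so the sum works on every cell.
  refine ⟨∑ i, |C i|, fun x hx => ?_⟩
  obtain ⟨i, hi⟩ := mesh.exists_open_cell hx.1 hx.2
  have h1 : ∀ y ∈ Set.Ioo (mesh.node i.castSucc) (mesh.node i.succ),
      (v : ℝ → ℝ) =ᶠ[nhds y] fun z => (q i).eval z := fun y hy => by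
    filter_upwards [isOpen_Ioo.mem_nhds hy] with z hz using hq i z (Set.Ioo_subset_Icc_self hz)
  have h2 : deriv (v : ℝ → ℝ) =ᶠ[nhds x] fun z => (q i).derivative.eval z := by
    filter_upwards [isOpen_Ioo.mem_nhds hi] with z hz
    rw [(h1 z hz).deriv_eq, Polynomial.deriv]
  have h3 : HasDerivAt (deriv (v : ℝ → ℝ)) ((q i).derivative.derivative.eval x) x :=
    ((q i).derivative.hasDerivAt x).congr_of_eventuallyEq h2
  refine ⟨h3.differentiableAt, ?_⟩
  rw [h3.deriv]
  exact (hC i x hx.1).trans ((le_abs_self _).trans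
    (Finset.single_le_sum (f := fun i => |C i|) (fun j _ => abs_nonneg _) (Finset.mem_univ i)))

theorem Vh_memLp_deriv (hr : 4 ≤ r) (v : Vh mesh r) :
    MemLp (deriv (v : ℝ → ℝ)) 2 (dx L) := by
  have hc := Vh_continuous_deriv hr v
  obtain ⟨C, hC⟩ := isCompact_Icc.exists_bound_of_continuousOn
    (hc.continuousOn (s := Set.Icc 0 L))
  refine MemLp.of_bound hc.aestronglyMeasurable C ?_
  filter_upwards [ae_restrict_mem measurableSet_Ioc] with x hx
  exact hC x (Set.Ioc_subset_Icc_self hx)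

theorem Vh_memLp_deriv_deriv (v : Vh mesh r) :
    MemLp (deriv (deriv (v : ℝ → ℝ))) 2 (dx L) := by
  obtain ⟨C, hC⟩ := Vh_second_deriv v
  refine MemLp.of_bound (measurable_deriv _).aestronglyMeasurable C ?_
  have hn : ∀ᵐ x ∂(dx L), x ∉ Set.range mesh.node :=
    ae_restrict_of_ae ((Set.finite_range mesh.node).countable.ae_notMem volume)
  filter_upwards [ae_restrict_mem measurableSet_Ioc, hn] with x hx hx'
  exact (hC x ⟨Set.Ioc_subset_Icc_self hx, hx'⟩).2

/-- Integration by parts for v v', which is continuous because r ≥ 4 makes v of class C¹, and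
differentiable off the finitely many nodes. Periodicity cancels the boundary terms. -/
theorem Vh_integral_deriv_sq (hL : 0 < L) (hr : 4 ≤ r) (v : Vh mesh r) :
    ip L (deriv (v : ℝ → ℝ)) (deriv (v : ℝ → ℝ))
      = - ip L v (deriv (deriv (v : ℝ → ℝ))) := by
  obtain ⟨C, hC⟩ := Vh_second_deriv v
  have hi1 : Integrable (fun x => deriv (v : ℝ → ℝ) x * deriv (v : ℝ → ℝ) x) (dx L) :=
    (Vh_memLp_deriv hr v).integrable_mul (Vh_memLp_deriv hr v)
  have hi2 : Integrable (fun x => (v : ℝ → ℝ) x * deriv (deriv (v : ℝ → ℝ)) x) (dx L) :=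
    (Vh_memLp v).integrable_mul (Vh_memLp_deriv_deriv v)
  have h := integral_eq_of_hasDerivAt_off_countable_of_le
    (fun x => (v : ℝ → ℝ) x * deriv (v : ℝ → ℝ) x)
    (fun x => deriv (v : ℝ → ℝ) x * deriv (v : ℝ → ℝ) x
      + (v : ℝ → ℝ) x * deriv (deriv (v : ℝ → ℝ)) x) hL.le
    (Set.finite_range mesh.node).countable
    ((Vh_contDiff_one hr v).continuous.mul (Vh_continuous_deriv hr v)).continuousOn
    (fun x hx => (Vh_hasDerivAt hr v x).mul
      (hC x ⟨Set.Ioo_subset_Icc_self hx.1, hx.2⟩).1.hasDerivAt)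
    ((intervalIntegrable_iff_integrableOn_Ioc_of_le hL.le).2 (hi1.add hi2))
  rw [intervalIntegral.integral_of_le hL.le, integral_add hi1 hi2, Vh_apply_period,
    Vh_deriv_apply_period, sub_self] at h
  unfold ip
  linarith

theorem Vh_integral_nonlinear (hL : 0 < L) (hr : 4 ≤ r) (v : Vh mesh r) :
    ip L (fun x => (v : ℝ → ℝ) x * deriv (v : ℝ → ℝ) x) v = 0 := by
  have hc := (Vh_contDiff_one hr v).continuous
  have hc' := Vh_continuous_deriv hr v
  have h := intervalIntegral.integral_eq_sub_of_hasDerivAt (a := 0) (b := L)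
    (f := fun x => (v : ℝ → ℝ) x ^ 3 / 3)
    (f' := fun x => (v : ℝ → ℝ) x * deriv (v : ℝ → ℝ) x * (v : ℝ → ℝ) x)
    (fun x _ => by
      convert! ((Vh_hasDerivAt hr v x).pow 3).div_const 3 using 1
      ring)
    (((hc.mul hc').mul hc).intervalIntegrable _ _)
  rw [intervalIntegral.integral_of_le hL.le, Vh_apply_period, sub_self] at h
  exact h

theorem inner_L2D_eq_ip (v w : L2D L) {f g : ℝ → ℝ} (hf : (v : Lp ℝ 2 (dx L)) =ᵐ[dx L] f)
    (hg : (w : Lp ℝ 2 (dx L)) =ᵐ[dx L] g) : inner ℝ v w = ip L f g := by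
  rw [Submodule.coe_inner, MeasureTheory.L2.inner_def]
  refine integral_congr_ae ?_
  filter_upwards [hf, hg] with x h1 h2
  rw [h1, h2]
  simp [mul_comm]

theorem toL2_ae (v : Vh mesh r) : (toL2 v : Lp ℝ 2 (dx L)) =ᵐ[dx L] (v : ℝ → ℝ) :=
  MemLp.coeFn_toLp (Vh_memLp v)

theorem nrm_eq_enorm (v : Vh mesh r) : nrm L (v : ℝ → ℝ) = ‖toL2 v‖ₑ := by
  have : ‖toL2 v‖ₑ = ‖(Vh_memLp v).toLp (v : ℝ → ℝ)‖ₑ := rfl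
  rw [this, Lp.enorm_toLp]
  rfl

theorem nrm_sq_eq_ofReal {f : ℝ → ℝ} (hf : MemLp f 2 (dx L)) :
    nrm L f ^ 2 = ENNReal.ofReal (ip L f f) := by
  have h1 : nrm L f = ‖hf.toLp f‖ₑ := (Lp.enorm_toLp hf).symm
  have h2 : ip L f f = ‖hf.toLp f‖ ^ 2 := by
    rw [← real_inner_self_eq_norm_sq, MeasureTheory.L2.inner_def]
    refine integral_congr_ae ?_
    filter_upwards [hf.coeFn_toLp] with x h
    rw [h]
    simp [pow_two]
  rw [h1, h2, ← ofReal_norm, ENNReal.ofReal_pow (norm_nonneg _)]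

/-- After integration by parts, the difference of the integrands is the square (νv'' + v)²/(2ν). -/
theorem Vh_deriv_sq_le (hL : 0 < L) (hr : 4 ≤ r) (v : Vh mesh r) {ν : ℝ} (hν : 0 < ν) :
    ip L (deriv (v : ℝ → ℝ)) (deriv (v : ℝ → ℝ)) ≤
      ν / 2 * ip L (deriv (deriv (v : ℝ → ℝ))) (deriv (deriv (v : ℝ → ℝ)))
        + 1 / (2 * ν) * ‖toL2 v‖ ^ 2 := by
  have hn : ‖toL2 v‖ ^ 2 = ip L v v := by
    rw [← real_inner_self_eq_norm_sq, inner_L2D_eq_ip _ _ (toL2_ae v) (toL2_ae v)]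
  rw [Vh_integral_deriv_sq hL hr, hn]
  have i1 : Integrable (fun x => (v : ℝ → ℝ) x * (v : ℝ → ℝ) x) (dx L) :=
    (Vh_memLp v).integrable_mul (Vh_memLp v)
  have i2 : Integrable (fun x => deriv (deriv (v : ℝ → ℝ)) x * deriv (deriv (v : ℝ → ℝ)) x)
      (dx L) := (Vh_memLp_deriv_deriv v).integrable_mul (Vh_memLp_deriv_deriv v)
  unfold ip
  rw [← integral_neg, ← integral_const_mul, ← integral_const_mul,
    ← integral_add (i2.const_mul _) (i1.const_mul _)]
  refine integral_mono ((Vh_memLp v).integrable_mul (Vh_memLp_deriv_deriv v)).neg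
    ((i2.const_mul _).add (i1.const_mul _)) fun x => ?_
  set a := (v : ℝ → ℝ) x
  set b := deriv (deriv (v : ℝ → ℝ)) x
  have : ν / 2 * (b * b) + 1 / (2 * ν) * (a * a) - -(a * b) = (ν * b + a) ^ 2 / (2 * ν) := by
    field_simp
    ring
  have h2 : 0 ≤ (ν * b + a) ^ 2 / (2 * ν) := by positivity
  simp only
  linarith

/-- The energy inequality for one step of the scheme. -/
theorem energy_step (hL : 0 < L) (hr : 4 ≤ r) {ν k ξ : ℝ} (hν : 0 < ν) (hk : 0 ≤ k)
    (u v : Vh mesh r) (b : L2D L)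
    (h : ip L (fun x => (v : ℝ → ℝ) x - (u : ℝ → ℝ) x) v
      + ν * k * ip L (deriv (deriv (v : ℝ → ℝ))) (deriv (deriv (v : ℝ → ℝ)))
      - k * ip L (deriv (v : ℝ → ℝ)) (deriv (v : ℝ → ℝ))
      + k * ip L (fun x => (v : ℝ → ℝ) x * deriv (v : ℝ → ℝ) x) v
      = ip L (fun x => (b : Lp ℝ 2 (dx L)) x * ξ) v) :
    (1 - k / ν) * ‖toL2 v‖ ^ 2
      + ν * k * ip L (deriv (deriv (v : ℝ → ℝ))) (deriv (deriv (v : ℝ → ℝ)))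
    ≤ ‖toL2 u‖ ^ 2 + 2 * inner ℝ b (toL2 u) * ξ + ‖b‖ ^ 2 * ξ ^ 2 := by
  rw [Vh_integral_nonlinear hL hr, mul_zero, add_zero] at h
  have h1 : ip L (fun x => (v : ℝ → ℝ) x - (u : ℝ → ℝ) x) v
      = inner ℝ (toL2 v - toL2 u) (toL2 v) := by
    refine (inner_L2D_eq_ip _ _ ?_ (toL2_ae v)).symm
    rw [Submodule.coe_sub]
    filter_upwards [Lp.coeFn_sub (toL2 v : Lp ℝ 2 (dx L)) (toL2 u), toL2_ae v, toL2_ae u]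
      with x hx h1 h2
    rw [hx, Pi.sub_apply, h1, h2]
  have h2 : ip L (fun x => (b : Lp ℝ 2 (dx L)) x * ξ) v = inner ℝ (ξ • b) (toL2 v) := by
    refine (inner_L2D_eq_ip _ _ ?_ (toL2_ae v)).symm
    rw [Submodule.coe_smul]
    filter_upwards [Lp.coeFn_smul ξ (b : Lp ℝ 2 (dx L))] with x hx
    rw [hx, Pi.smul_apply, smul_eq_mul, mul_comm]
  have h3 := mul_le_mul_of_nonneg_left (Vh_deriv_sq_le hL hr v hν) hk
  set D := ip L (deriv (deriv (v : ℝ → ℝ))) (deriv (deriv (v : ℝ → ℝ)))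
  set x := toL2 u
  -- The increment d depends on ξ, so its pairing with the noise must be estimated, whereas the
  -- pairing of b with x is kept exactly.
  obtain ⟨d, hd⟩ : ∃ d, toL2 v = x + d := ⟨toL2 v - x, by abel⟩
  rw [hd] at h1 h2 h3 ⊢
  have e1 : inner ℝ (x + d - x) (x + d) = inner ℝ x d + ‖d‖ ^ 2 := by
    rw [add_sub_cancel_left, inner_add_right, real_inner_self_eq_norm_sq, real_inner_comm]
  have e2 : ‖x + d‖ ^ 2 = ‖x‖ ^ 2 + 2 * inner ℝ x d + ‖d‖ ^ 2 := norm_add_sq_real x d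
  have e3 : inner ℝ (ξ • b) (x + d) = ξ * inner ℝ b x + inner ℝ (ξ • b) d := by
    rw [inner_add_right]
    exact congrArg (· + _) (real_inner_smul_left b x ξ)
  -- Young's inequality 2(ξb, d) ≤ ξ²‖b‖² + ‖d‖². The claim is twice `h` combined with this and
  -- twice `h3`.
  have e4 : 0 ≤ ‖ξ • b - d‖ ^ 2 := by positivity
  rw [norm_sub_sq_real, norm_smul, mul_pow, Real.norm_eq_abs, sq_abs] at e4
  rw [h1, h2, e1, e3] at h
  have e5 : k * (1 / (2 * ν) * ‖x + d‖ ^ 2) = k / ν * ‖x + d‖ ^ 2 / 2 := by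
    field_simp
  rw [mul_add, e5] at h3
  nlinarith

theorem norm_projection_le {u₀ : L2D L} {v : Vh mesh r}
    (h : ip L (fun x => (u₀ : Lp ℝ 2 (dx L)) x - (v : ℝ → ℝ) x) v = 0) : ‖toL2 v‖ ≤ ‖u₀‖ := by
  have h1 : ip L (fun x => (u₀ : Lp ℝ 2 (dx L)) x - (v : ℝ → ℝ) x) v
      = inner ℝ (u₀ - toL2 v) (toL2 v) := by
    refine (inner_L2D_eq_ip _ _ ?_ (toL2_ae v)).symm
    rw [Submodule.coe_sub]
    filter_upwards [Lp.coeFn_sub (u₀ : Lp ℝ 2 (dx L)) (toL2 v), toL2_ae v] with x hx h1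
    rw [hx, Pi.sub_apply, h1]
  rw [h1, inner_sub_left, real_inner_self_eq_norm_sq] at h
  have h2 := real_inner_le_norm u₀ (toL2 v)
  by_contra! hlt
  nlinarith [norm_nonneg u₀, norm_nonneg (toL2 v)]

end FiniteElements

end SKS

noncomputable section

namespace SKS

/-! ### Gaussian moments of the one-step growth factor -/

section GaussianMoments

theorem integrable_pow_gaussianReal (v : ℝ≥0) (n : ℕ) :
    Integrable (fun x : ℝ => x ^ n) (gaussianReal 0 v) := by
  have h := (memLp_id_gaussianReal (μ := 0) (v := v) (n : ℝ≥0)).integrable_norm_pow'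
  refine (integrable_norm_iff (by fun_prop)).1 ?_
  simpa using h

theorem integral_pow_gaussianReal (v : ℝ≥0) (n : ℕ) :
    ∫ x : ℝ, x ^ n ∂(gaussianReal 0 v) = √v ^ n * ∫ x : ℝ, x ^ n ∂(gaussianReal 0 1) := by
  have h := gaussianReal_map_const_mul (μ := 0) (v := 1) (√v)
  have h2 : NNReal.mk (√(v : ℝ) ^ 2) (sq_nonneg _) * 1 = v := by
    ext
    simp
  rw [mul_zero, h2] at h
  rw [← h, integral_map (by fun_prop) (by fun_prop), ← integral_const_mul]
  simp only [mul_pow]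

/-- The term linear in x is kept exactly because it integrates to zero against a centred Gaussian;
all others are dominated by their extreme powers, the second and the tenth. Here 1008 = 10·3² +
10·3³ + 5·3⁴ + 3⁵, and 1013 adds the quadratic part of 5s. -/
theorem one_add_pow_five_le {γ β x : ℝ} (h : γ ^ 2 ≤ β) :
    (1 + 2 * γ * x + β * x ^ 2) ^ 5 ≤
      1 + 10 * γ * x + 1013 * β * x ^ 2 + 1008 * β ^ 5 * x ^ 10 := by
  have hβ : 0 ≤ β := (sq_nonneg γ).trans h
  obtain ⟨c, hc, rfl⟩ : ∃ c, 0 ≤ c ∧ β = c ^ 2 := ⟨√β, Real.sqrt_nonneg _, (Real.sq_sqrt hβ).symm⟩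
  have hγ : |γ| ≤ c := abs_le_of_sq_le_sq h hc
  -- Everything reduces to the single variable y = √β |x|, with |s| ≤ 2y + y², at most 3y for y ≤ 1
  -- and 3y² for y ≥ 1.
  obtain ⟨y, hy⟩ : ∃ y, y = c * |x| := ⟨_, rfl⟩
  have hy0 : 0 ≤ y := by rw [hy]; positivity
  have hy2 : c ^ 2 * x ^ 2 = y ^ 2 := by rw [hy, mul_pow, sq_abs]
  have hy10 : (c ^ 2) ^ 5 * x ^ 10 = y ^ 10 := by
    rw [show (c ^ 2) ^ 5 * x ^ 10 = (c ^ 2 * x ^ 2) ^ 5 by ring, hy2]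
    ring
  obtain ⟨s, hs⟩ : ∃ s, s = 2 * γ * x + c ^ 2 * x ^ 2 := ⟨_, rfl⟩
  have hs1 : |s| ≤ 2 * y + y ^ 2 := by
    rw [hs, hy2]
    refine (abs_add_le _ _).trans ?_
    rw [abs_mul, abs_mul, abs_two, abs_of_nonneg (sq_nonneg y), hy]
    have := mul_le_mul_of_nonneg_right hγ (abs_nonneg x)
    linarith
  have e1 : (1 + 2 * γ * x + c ^ 2 * x ^ 2) ^ 5
      = 1 + 5 * s + (10 * s ^ 2 + 10 * s ^ 3 + 5 * s ^ 4 + s ^ 5) := by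
    rw [show 1 + 2 * γ * x + c ^ 2 * x ^ 2 = 1 + s by rw [hs]; ring]
    ring
  have e2 : 10 * s ^ 2 + 10 * s ^ 3 + 5 * s ^ 4 + s ^ 5
      ≤ 10 * |s| ^ 2 + 10 * |s| ^ 3 + 5 * |s| ^ 4 + |s| ^ 5 := by
    have h2 := le_abs_self (s ^ 2)
    have h3 := le_abs_self (s ^ 3)
    have h4 := le_abs_self (s ^ 4)
    have h5 := le_abs_self (s ^ 5)
    rw [abs_pow] at h2 h3 h4 h5
    linarith
  have e3 : 10 * |s| ^ 2 + 10 * |s| ^ 3 + 5 * |s| ^ 4 + |s| ^ 5 ≤ 1008 * y ^ 2 + 1008 * y ^ 10 := by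
    have mono : ∀ z, |s| ≤ z → 10 * |s| ^ 2 + 10 * |s| ^ 3 + 5 * |s| ^ 4 + |s| ^ 5 ≤
        10 * z ^ 2 + 10 * z ^ 3 + 5 * z ^ 4 + z ^ 5 := fun z hz => by gcongr
    rcases le_total y 1 with h1 | h1
    · refine (mono (3 * y) (by nlinarith)).trans ?_
      have h3 : y ^ 3 ≤ y ^ 2 := pow_le_pow_of_le_one hy0 h1 (by norm_num)
      have h4 : y ^ 4 ≤ y ^ 2 := pow_le_pow_of_le_one hy0 h1 (by norm_num)
      have h5 : y ^ 5 ≤ y ^ 2 := pow_le_pow_of_le_one hy0 h1 (by norm_num)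
      have h10 : 0 ≤ y ^ 10 := by positivity
      linear_combination 270 * h3 + 405 * h4 + 243 * h5 + 1008 * h10
    · refine (mono (3 * y ^ 2) (by nlinarith)).trans ?_
      have h4 : y ^ 4 ≤ y ^ 10 := pow_le_pow_right₀ h1 (by norm_num)
      have h6 : y ^ 6 ≤ y ^ 10 := pow_le_pow_right₀ h1 (by norm_num)
      have h8 : y ^ 8 ≤ y ^ 10 := pow_le_pow_right₀ h1 (by norm_num)
      have h10 : 0 ≤ y ^ 2 := by positivity
      linear_combination 90 * h4 + 270 * h6 + 405 * h8 + 1008 * h10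
  rw [e1]
  have e4 : 5 * s = 10 * γ * x + 5 * y ^ 2 := by rw [hs, hy2]; ring
  have e5 : 1013 * c ^ 2 * x ^ 2 = 1013 * y ^ 2 := by rw [mul_assoc, hy2]
  have e6 : 1008 * (c ^ 2) ^ 5 * x ^ 10 = 1008 * y ^ 10 := by rw [mul_assoc, hy10]
  rw [e5, e6]
  linarith

/-- The rate at which fifth powers of the energy grow because of the noise. -/
def noiseRate (β : ℝ) (v : ℝ) : ℝ :=
  1013 * β * (∫ x : ℝ, x ^ 2 ∂(gaussianReal 0 1))
    + 1008 * β ^ 5 * (∫ x : ℝ, x ^ 10 ∂(gaussianReal 0 1)) * v ^ 4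

theorem noiseRate_nonneg {β v : ℝ} (hβ : 0 ≤ β) : 0 ≤ noiseRate β v := by
  have h2 : 0 ≤ ∫ x : ℝ, x ^ 2 ∂(gaussianReal 0 1) := integral_nonneg fun x => by positivity
  have h10 : 0 ≤ ∫ x : ℝ, x ^ 10 ∂(gaussianReal 0 1) := integral_nonneg fun x => by positivity
  unfold noiseRate
  positivity

theorem noiseRate_mono {β v v' : ℝ} (hβ : 0 ≤ β) (hv : 0 ≤ v) (h : v ≤ v') :
    noiseRate β v ≤ noiseRate β v' := by
  have h10 : 0 ≤ ∫ x : ℝ, x ^ 10 ∂(gaussianReal 0 1) := integral_nonneg fun x => by positivity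
  unfold noiseRate
  gcongr

/-- The mean of the polynomial bound is 1 + `noiseRate β v` · v, and 1 + t ≤ exp t. The bound does
not involve γ, so it can be used with a random γ. -/
theorem lintegral_gaussian_pow_five_le {γ β : ℝ} (h : γ ^ 2 ≤ β) (v : ℝ≥0) :
    ∫⁻ x, ENNReal.ofReal ((1 + 2 * γ * x + β * x ^ 2) ^ 5) ∂(gaussianReal 0 v)
      ≤ ENNReal.ofReal (Real.exp (noiseRate β v * v)) := by
  have hx := fun x => one_add_pow_five_le (x := x) h
  have hpos : ∀ x : ℝ, 0 ≤ 1 + 2 * γ * x + β * x ^ 2 := fun x => by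
    nlinarith [sq_nonneg (1 + γ * x), mul_le_mul_of_nonneg_right h (sq_nonneg x)]
  have i0 : Integrable (fun _ : ℝ => (1 : ℝ)) (gaussianReal 0 v) := integrable_const 1
  have i1 : Integrable (fun x : ℝ => 10 * γ * x) (gaussianReal 0 v) := by
    simpa using (integrable_pow_gaussianReal v 1).const_mul (10 * γ)
  have i2 := (integrable_pow_gaussianReal v 2).const_mul (1013 * β)
  have i3 := (integrable_pow_gaussianReal v 10).const_mul (1008 * β ^ 5)
  have i01 : Integrable (fun x : ℝ => 1 + 10 * γ * x) (gaussianReal 0 v) := i0.add i1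
  have i02 : Integrable (fun x : ℝ => 1 + 10 * γ * x + 1013 * β * x ^ 2) (gaussianReal 0 v) :=
    i01.add i2
  have i03 : Integrable (fun x : ℝ => 1 + 10 * γ * x + 1013 * β * x ^ 2
    + 1008 * β ^ 5 * x ^ 10) (gaussianReal 0 v) := i02.add i3
  refine (lintegral_mono fun x => ENNReal.ofReal_le_ofReal (hx x)).trans ?_
  rw [← ofReal_integral_eq_lintegral_ofReal i03
    (ae_of_all _ fun x => (pow_nonneg (hpos x) 5).trans (hx x))]
  refine ENNReal.ofReal_le_ofReal ?_
  rw [integral_add i02 i3, integral_add i01 i2, integral_add i0 i1,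
    integral_const_mul, integral_const_mul, integral_const_mul, integral_pow_gaussianReal,
    integral_pow_gaussianReal v 10, integral_id_gaussianReal]
  have e2 : √(v : ℝ) ^ 2 = v := Real.sq_sqrt v.2
  have e10 : √(v : ℝ) ^ 10 = v ^ 5 := by
    rw [show √(v : ℝ) ^ 10 = (√(v : ℝ) ^ 2) ^ 5 by ring, e2]
  have he := Real.add_one_le_exp (noiseRate β v * v)
  rw [e2, e10]
  refine le_trans (le_of_eq ?_) he
  simp [noiseRate]
  ring

end GaussianMoments

/-! ### Integrating out an independent increment -/

section Independence

/-- Integrating out an independent factor, with a bound that is uniform in the other variable. -/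
theorem lintegral_mul_le_of_indep {Ω : Type*} {𝒢 mΩ : MeasurableSpace Ω} {P : Measure Ω}
    [IsProbabilityMeasure P] (h𝒢 : 𝒢 ≤ mΩ) {ξ : Ω → ℝ}
    {μ : Measure ℝ} [IsProbabilityMeasure μ]
    (hξ : HasLaw ξ μ P) (hind : Indep (MeasurableSpace.comap ξ inferInstance) 𝒢 P)
    {g : Ω → ℝ≥0∞} (hg : Measurable[𝒢] g) {γ : Ω → ℝ} (hγ : Measurable[𝒢] γ)
    {F : ℝ → ℝ → ℝ≥0∞} (hF : Measurable (Function.uncurry F)) {c : ℝ≥0∞}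
    (hc : ∀ ω, ∫⁻ x, F (γ ω) x ∂μ ≤ c) :
    ∫⁻ ω, g ω * F (γ ω) (ξ ω) ∂P ≤ c * ∫⁻ ω, g ω ∂P := by
  have hX : Measurable[𝒢] fun ω => (g ω, γ ω) := hg.prodMk hγ
  have hX' : Measurable fun ω => (g ω, γ ω) := hX.mono h𝒢 le_rfl
  -- Both 𝒢-measurable factors are treated as one pair, so that the joint law with ξ is a product
  -- and Tonelli applies.
  have hind' : IndepFun (fun ω => (g ω, γ ω)) ξ P := by
    rw [IndepFun_iff_Indep]
    exact indep_of_indep_of_le_left hind.symm hX.comap_le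
  have hmap := hind'.map_prod_eq_prod_map_map hX'.aemeasurable hξ.aemeasurable
  have hmeas : Measurable fun p : (ℝ≥0∞ × ℝ) × ℝ => p.1.1 * F p.1.2 p.2 :=
    (measurable_fst.comp measurable_fst).mul
      (hF.comp ((measurable_snd.comp measurable_fst).prodMk measurable_snd))
  have e1 : ∫⁻ ω, g ω * F (γ ω) (ξ ω) ∂P
      = ∫⁻ p, p.1.1 * F p.1.2 p.2 ∂(P.map fun ω => ((g ω, γ ω), ξ ω)) :=
    (lintegral_map' hmeas.aemeasurable (hX'.aemeasurable.prodMk hξ.aemeasurable)).symm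
  rw [e1, hmap, hξ.map_eq, lintegral_prod _ hmeas.aemeasurable,
    lintegral_map hmeas.lintegral_prod_right' hX', ← lintegral_const_mul _ (hg.mono h𝒢 le_rfl)]
  refine lintegral_mono fun ω => ?_
  have hFm : Measurable (F (γ ω)) := hF.of_uncurry_left
  simp only
  rw [lintegral_const_mul _ hFm, mul_comm]
  exact mul_le_mul_left (hc ω) _

end Independence

/-! ### Maximal inequality by stopping, and its strong form -/

section Maximal

variable {Ω : Type*} {mΩ : MeasurableSpace Ω} {P : Measure Ω}

/-- The process `Y`, frozen as soon as it reaches the level `a`. -/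
def frozenAt (Y : ℕ → Ω → ℝ≥0∞) (a : ℝ≥0∞) : ℕ → Ω → ℝ≥0∞
  | 0 => Y 0
  | n + 1 => fun ω => if a ≤ frozenAt Y a n ω then frozenAt Y a n ω else Y (n + 1) ω

theorem frozenAt_eq_of_lt (Y : ℕ → Ω → ℝ≥0∞) (a : ℝ≥0∞) (n : ℕ) (ω : Ω)
    (h : ¬ a ≤ frozenAt Y a n ω) : frozenAt Y a n ω = Y n ω := by
  cases n with
  | zero => rfl
  | succ n =>
    simp only [frozenAt] at h ⊢
    split_ifs with h'
    · rw [if_pos h'] at h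
      exact absurd h' h
    · rfl

theorem le_frozenAt (Y : ℕ → Ω → ℝ≥0∞) (a : ℝ≥0∞) {j n : ℕ} (hjn : j ≤ n) (ω : Ω)
    (h : a ≤ Y j ω) : a ≤ frozenAt Y a n ω := by
  induction n, hjn using Nat.le_induction with
  | base =>
    by_contra h'
    exact h' (by rwa [frozenAt_eq_of_lt Y a j ω h'])
  | succ n _ ih => simpa only [frozenAt, if_pos ih] using ih

variable {𝒢 : Filtration ℕ mΩ}

theorem measurable_frozenAt {Y : ℕ → Ω → ℝ≥0∞} {M : ℕ} (hY : ∀ n ≤ M, Measurable[𝒢 n] (Y n))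
    (a : ℝ≥0∞) : ∀ n ≤ M, Measurable[𝒢 n] (frozenAt Y a n) := by
  intro n
  induction n with
  | zero => exact hY 0
  | succ n ih =>
    intro hn
    have h1 : Measurable[𝒢 (n + 1)] (frozenAt Y a n) :=
      (ih (by omega)).mono (𝒢.mono n.le_succ) le_rfl
    exact Measurable.ite (measurableSet_le measurable_const h1) h1 (hY _ hn)

/-- A maximal inequality for nonnegative processes that grow on average by at most the factor `κ`
in each step. -/
theorem maximal_inequality {Y : ℕ → Ω → ℝ≥0∞} {M : ℕ} (hY : ∀ n ≤ M, Measurable[𝒢 n] (Y n))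
    {κ : ℝ≥0∞} (hκ : 1 ≤ κ)
    (hstep : ∀ n < M, ∀ g : Ω → ℝ≥0∞, Measurable[𝒢 n] g →
      ∫⁻ ω, g ω * Y (n + 1) ω ∂P ≤ κ * ∫⁻ ω, g ω * Y n ω ∂P)
    {w : Ω → ℝ≥0∞} (hw : Measurable[𝒢 0] w) (a : ℝ≥0∞) :
    a * ∫⁻ ω, w ω * Set.indicator {ω | ∃ n ≤ M, a ≤ Y n ω} 1 ω ∂P
      ≤ κ ^ M * ∫⁻ ω, w ω * Y 0 ω ∂P := by
  have hZ := measurable_frozenAt (𝒢 := 𝒢) hY a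
  have key : ∀ n ≤ M, ∫⁻ ω, w ω * frozenAt Y a n ω ∂P ≤ κ ^ n * ∫⁻ ω, w ω * Y 0 ω ∂P := by
    intro n
    induction n with
    | zero => simp [frozenAt]
    | succ n ih =>
      intro hn
      have hZn := hZ n (by omega)
      have hwn : Measurable[𝒢 n] w := hw.mono (𝒢.mono (Nat.zero_le n)) le_rfl
      have hs : MeasurableSet[𝒢 n] {ω | a ≤ frozenAt Y a n ω} :=
        measurableSet_le measurable_const hZn
      -- Splitting the weight by whether the process is already frozen: a frozen path is constant
      -- and needs only κ ≥ 1, a live one is governed by `hstep` with the weight g₂, known at time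
      -- n.
      let g₁ : Ω → ℝ≥0∞ := {ω | a ≤ frozenAt Y a n ω}.indicator w
      let g₂ : Ω → ℝ≥0∞ := {ω | a ≤ frozenAt Y a n ω}ᶜ.indicator w
      have hg₁ : Measurable[𝒢 n] g₁ := hwn.indicator hs
      have hg₂ : Measurable[𝒢 n] g₂ := hwn.indicator hs.compl
      have hm1 : Measurable fun ω => g₁ ω * frozenAt Y a n ω :=
        (hg₁.mono (𝒢.le n) le_rfl).mul (hZn.mono (𝒢.le n) le_rfl)
      have e1 : ∀ ω, w ω * frozenAt Y a (n + 1) ω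
          = g₁ ω * frozenAt Y a n ω + g₂ ω * Y (n + 1) ω := fun ω => by
        by_cases h : a ≤ frozenAt Y a n ω <;> simp [g₁, g₂, frozenAt, h]
      have e2 : ∀ ω, w ω * frozenAt Y a n ω
          = g₁ ω * frozenAt Y a n ω + g₂ ω * Y n ω := fun ω => by
        by_cases h : a ≤ frozenAt Y a n ω
        · simp [g₁, g₂, h]
        · have := frozenAt_eq_of_lt Y a n ω h
          rw [this] at h ⊢
          simp only [Set.indicator, Set.mem_compl_iff, Set.mem_ofPred_eq, this, g₁, g₂, h]
          simp
      calc ∫⁻ ω, w ω * frozenAt Y a (n + 1) ω ∂P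
          = ∫⁻ ω, g₁ ω * frozenAt Y a n ω ∂P + ∫⁻ ω, g₂ ω * Y (n + 1) ω ∂P := by
            simp_rw [e1]
            rw [lintegral_add_left hm1]
        _ ≤ κ * ∫⁻ ω, g₁ ω * frozenAt Y a n ω ∂P + κ * ∫⁻ ω, g₂ ω * Y n ω ∂P :=
            add_le_add (le_mul_of_one_le_left zero_le hκ) (hstep n (by omega) g₂ hg₂)
        _ = κ * ∫⁻ ω, w ω * frozenAt Y a n ω ∂P := by
            simp_rw [e2]
            rw [lintegral_add_left hm1, mul_add]
        _ ≤ κ ^ (n + 1) * ∫⁻ ω, w ω * Y 0 ω ∂P := by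
            rw [pow_succ', mul_assoc]
            exact mul_le_mul_right (ih (by omega)) κ
  refine le_trans ?_ (key M le_rfl)
  refine (lintegral_const_mul_le _ _).trans (lintegral_mono fun ω => ?_)
  by_cases h : ∃ n ≤ M, a ≤ Y n ω
  · obtain ⟨n, hn, hn'⟩ := h
    have h1 : ω ∈ {ω | ∃ n ≤ M, a ≤ Y n ω} := ⟨n, hn, hn'⟩
    simp only [Set.indicator_of_mem h1, Pi.one_apply, mul_one]
    rw [mul_comm]
    exact mul_le_mul_right (le_frozenAt Y a hn ω hn') _
  · have h1 : ω ∉ {ω | ∃ n ≤ M, a ≤ Y n ω} := h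
    simp [Set.indicator_of_notMem h1]

/-- Fourth powers of the running maximum are controlled when fifth powers grow on average by at
most the factor `κ` in each step. -/
theorem lintegral_sup_pow_four_le {ρ : ℕ → Ω → ℝ} {M : ℕ}
    (hρ : ∀ n ≤ M, Measurable[𝒢 n] (ρ n)) (hρ0 : ∀ ω, ρ 0 ω = 1) (hρn : ∀ n ω, 0 ≤ ρ n ω)
    {κ : ℝ≥0∞} (hκ : 1 ≤ κ)
    (hstep : ∀ n < M, ∀ g : Ω → ℝ≥0∞, Measurable[𝒢 n] g →
      ∫⁻ ω, g ω * ENNReal.ofReal (ρ (n + 1) ω ^ 5) ∂P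
        ≤ κ * ∫⁻ ω, g ω * ENNReal.ofReal (ρ n ω ^ 5) ∂P)
    {w : Ω → ℝ≥0∞} (hw : Measurable[𝒢 0] w) :
    ∫⁻ ω, w ω * (⨆ n ∈ Finset.Icc 0 M, ENNReal.ofReal (ρ n ω ^ 4)) ∂P
      ≤ 32 * κ ^ M * ∫⁻ ω, w ω ∂P := by
  let Y : ℕ → Ω → ℝ≥0∞ := fun n ω => ENNReal.ofReal (ρ n ω ^ 5)
  have hY : ∀ n ≤ M, Measurable[𝒢 n] (Y n) := fun n hn =>
    ((hρ n hn).pow_const 5).ennreal_ofReal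
  -- Since Y = ρ^5 and 32 = 2^5, this is the event that ρ reaches 2^j.
  let S : ℕ → Set Ω := fun j => {ω | ∃ n ≤ M, (32 : ℝ≥0∞) ^ j ≤ Y n ω}
  have hS : ∀ j, MeasurableSet (S j) := fun j => by
    have : S j = ⋃ n ∈ Set.Iic M, {ω | (32 : ℝ≥0∞) ^ j ≤ Y n ω} := by
      ext ω
      simp [S]
    rw [this]
    refine MeasurableSet.biUnion (Set.to_countable _) fun n hn => ?_
    exact measurableSet_le measurable_const ((hY n hn).mono (𝒢.le n) le_rfl)
  have hpt : ∀ ω, (⨆ n ∈ Finset.Icc 0 M, ENNReal.ofReal (ρ n ω ^ 4))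
      ≤ ∑' j : ℕ, 16 * 16 ^ j * (S j).indicator 1 ω := fun ω => by
    refine iSup₂_le fun n hn => ?_
    have hnM : n ≤ M := (Finset.mem_Icc.1 hn).2
    rcases le_total (ρ n ω) 1 with h1 | h1
    · have h0 : ω ∈ S 0 := ⟨0, Nat.zero_le _, by simp [Y, hρ0]⟩
      refine le_trans ?_ (ENNReal.le_tsum 0)
      rw [Set.indicator_of_mem h0]
      have : ENNReal.ofReal (ρ n ω ^ 4) ≤ 1 := by
        rw [ENNReal.ofReal_le_one]
        exact pow_le_one₀ (hρn n ω) h1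
      refine this.trans ?_
      norm_num
    · obtain ⟨j, hj1, hj2⟩ := exists_nat_pow_near h1 (one_lt_two)
      have h0 : ω ∈ S j := by
        refine ⟨n, hnM, ?_⟩
        have e : (32 : ℝ≥0∞) ^ j = ENNReal.ofReal ((2 ^ j) ^ 5) := by
          rw [← pow_mul, mul_comm, pow_mul, ENNReal.ofReal_pow (by norm_num)]
          norm_num
        rw [e]
        exact ENNReal.ofReal_le_ofReal (by gcongr)
      refine le_trans ?_ (ENNReal.le_tsum j)
      rw [Set.indicator_of_mem h0]
      have e : (16 : ℝ≥0∞) * 16 ^ j * (1 : Ω → ℝ≥0∞) ω = ENNReal.ofReal ((2 ^ (j + 1)) ^ 4) := by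
        rw [← pow_mul, mul_comm (j + 1), pow_mul, ENNReal.ofReal_pow (by norm_num), pow_succ']
        norm_num
      rw [e]
      exact ENNReal.ofReal_le_ofReal (pow_le_pow_left₀ (hρn n ω) hj2.le 4)
  have hw' : Measurable w := hw.mono (𝒢.le 0) le_rfl
  have hind : ∀ j, Measurable ((S j).indicator (1 : Ω → ℝ≥0∞)) := fun j =>
    measurable_one.indicator (hS j)
  have hlev : ∀ j, ∫⁻ ω, w ω * (16 * 16 ^ j * (S j).indicator 1 ω) ∂P
      ≤ 16 * κ ^ M * (∫⁻ ω, w ω ∂P) * 2⁻¹ ^ j := fun j => by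
    have h := maximal_inequality (P := P) (𝒢 := 𝒢) hY hκ hstep hw (32 ^ j)
    have hY0 : ∀ ω, w ω * Y 0 ω = w ω := fun ω => by simp [Y, hρ0]
    simp_rw [hY0] at h
    have e1 : ∀ ω, w ω * (16 * 16 ^ j * (S j).indicator 1 ω)
        = 16 * 16 ^ j * (w ω * (S j).indicator 1 ω) := fun ω => by ring
    simp_rw [e1]
    rw [lintegral_const_mul (f := fun ω => w ω * (S j).indicator 1 ω) _ (hw'.mul (hind j))]
    -- The gain 2^{-j} between fourth and fifth powers is what makes the sum over levels converge.
    have e2 : (16 : ℝ≥0∞) ^ j = 32 ^ j * 2⁻¹ ^ j := by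
      rw [← mul_pow, show (32 : ℝ≥0∞) = 16 * 2 by norm_num, mul_assoc,
        ENNReal.mul_inv_cancel (by norm_num) (by norm_num), mul_one]
    calc 16 * 16 ^ j * ∫⁻ ω, w ω * (S j).indicator 1 ω ∂P
        = 16 * 2⁻¹ ^ j * (32 ^ j * ∫⁻ ω, w ω * (S j).indicator 1 ω ∂P) := by
          rw [e2]; ring
      _ ≤ 16 * 2⁻¹ ^ j * (κ ^ M * ∫⁻ ω, w ω ∂P) := mul_le_mul_right h _
      _ = _ := by ring
  calc ∫⁻ ω, w ω * (⨆ n ∈ Finset.Icc 0 M, ENNReal.ofReal (ρ n ω ^ 4)) ∂P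
      ≤ ∫⁻ ω, ∑' j : ℕ, w ω * (16 * 16 ^ j * (S j).indicator 1 ω) ∂P :=
        lintegral_mono fun ω => by
          rw [ENNReal.tsum_mul_left]
          exact mul_le_mul_right (hpt ω) _
    _ = ∑' j : ℕ, ∫⁻ ω, w ω * (16 * 16 ^ j * (S j).indicator 1 ω) ∂P :=
        lintegral_tsum fun j => (hw'.mul ((hind j).const_mul _)).aemeasurable
    _ ≤ ∑' j : ℕ, 16 * κ ^ M * (∫⁻ ω, w ω ∂P) * 2⁻¹ ^ j := ENNReal.tsum_le_tsum hlev
    _ = 32 * κ ^ M * ∫⁻ ω, w ω ∂P := by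
        rw [ENNReal.tsum_mul_left, ENNReal.tsum_geometric, ENNReal.one_sub_inv_two, inv_inv]
        rw [show (32 : ℝ≥0∞) = 16 * 2 by norm_num]
        ring

end Maximal

end SKS

end

noncomputable section

namespace SKS

/-! ### Moment and dissipation bounds from the energy inequality -/

section EnergyScheme

/-- Separates the initial energy, raised to q/2, from the energy ratio, whose exponent q/2 ≤ 4 lies
within reach of the fourth-power maximal bound. -/
theorem enorm_rpow_le {H : Type*} [NormedAddCommGroup H] (x y : H) {q : ℝ} (hq0 : 0 ≤ q) (hq8 : q ≤ 8) :
    ‖x‖ₑ ^ q ≤ ENNReal.ofReal ((1 + ‖y‖ ^ 2) ^ (q / 2)) *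
      max 1 (ENNReal.ofReal (((1 + ‖x‖ ^ 2) / (1 + ‖y‖ ^ 2)) ^ 4)) := by
  have hy : 0 < 1 + ‖y‖ ^ 2 := by positivity
  have hx : 0 < 1 + ‖x‖ ^ 2 := by positivity
  set ρ := (1 + ‖x‖ ^ 2) / (1 + ‖y‖ ^ 2) with hρ
  have hρ0 : 0 < ρ := div_pos hx hy
  have h1 : ‖x‖ ^ q ≤ (1 + ‖y‖ ^ 2) ^ (q / 2) * ρ ^ (q / 2) := by
    rw [← Real.mul_rpow hy.le hρ0.le, hρ, mul_div_cancel₀ _ hy.ne']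
    calc ‖x‖ ^ q = (‖x‖ ^ 2) ^ (q / 2) := by
          rw [← Real.rpow_natCast, ← Real.rpow_mul (norm_nonneg x)]
          congr 1
          push_cast
          ring
      _ ≤ (1 + ‖x‖ ^ 2) ^ (q / 2) := by gcongr; linarith
  have h2 : ρ ^ (q / 2) ≤ max 1 (ρ ^ 4) := by
    rcases le_total ρ 1 with h | h
    · exact (Real.rpow_le_one hρ0.le h (by linarith)).trans (le_max_left _ _)
    · refine le_trans ?_ (le_max_right _ _)
      rw [← Real.rpow_natCast]
      exact Real.rpow_le_rpow_of_exponent_le h (by push_cast; linarith)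
  rw [← ofReal_norm, ENNReal.ofReal_rpow_of_nonneg (norm_nonneg x) hq0, ← ENNReal.ofReal_one,
    ← ENNReal.ofReal_max, ← ENNReal.ofReal_mul (by positivity)]
  exact ENNReal.ofReal_le_ofReal (h1.trans (by gcongr))

variable {Ω : Type*} {mΩ : MeasurableSpace Ω} {H : Type*} [NormedAddCommGroup H]
  [InnerProductSpace ℝ H]

/-- An adapted Hilbert space valued sequence `X` driven by independent Gaussian increments `ξ` of
variance `k` that satisfies the energy inequality of the semi-implicit scheme, with dissipation
`D`, where `B` grows at most linearly. -/
structure IsEnergyScheme (P : Measure Ω) (𝒢 : Filtration ℕ mΩ) (ν β : ℝ) (k : ℝ≥0) (M : ℕ)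
    (B : H → H) (ξ : ℕ → Ω → ℝ) (X : ℕ → Ω → H) (D : ℕ → Ω → ℝ) : Prop where
  ν_pos : 0 < ν
  step_le : (k : ℝ) ≤ ν / 2
  continuous_noise : Continuous B
  growth : ∀ x, ‖B x‖ ^ 2 ≤ β * (1 + ‖x‖ ^ 2)
  adapted : ∀ n ≤ M, StronglyMeasurable[𝒢 n] (X n)
  law : ∀ n, HasLaw (ξ n) (gaussianReal 0 k) P
  indep : ∀ n, Indep (MeasurableSpace.comap (ξ n) inferInstance) (𝒢 n) P
  dissipation_nonneg : ∀ n ω, 0 ≤ D n ω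
  energy : ∀ᵐ ω ∂P, ∀ n < M, (1 - k / ν) * ‖X (n + 1) ω‖ ^ 2 + ν * k * D (n + 1) ω
    ≤ ‖X n ω‖ ^ 2 + 2 * inner ℝ (B (X n ω)) (X n ω) * ξ n ω + ‖B (X n ω)‖ ^ 2 * ξ n ω ^ 2

/-- The exponential growth rate of the moments. -/
def growthRate (ν β : ℝ) : ℝ := 10 / ν + noiseRate β (ν / 2)

variable {P : Measure Ω} {𝒢 : Filtration ℕ mΩ} {ν β : ℝ} {k : ℝ≥0} {M : ℕ} {B : H → H}
  {ξ : ℕ → Ω → ℝ} {X : ℕ → Ω → H} {D : ℕ → Ω → ℝ}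

namespace IsEnergyScheme

theorem β_nonneg (h : IsEnergyScheme P 𝒢 ν β k M B ξ X D) : 0 ≤ β := by
  have h0 := h.growth 0
  rw [norm_zero] at h0
  nlinarith [sq_nonneg ‖B 0‖]

theorem measurable_inner (h : IsEnergyScheme P 𝒢 ν β k M B ξ X D) {n : ℕ} (hn : n ≤ M) :
    Measurable[𝒢 n] fun ω => (inner ℝ (B (X n ω)) (X n ω) : ℝ) :=
  ((h.continuous_noise.comp_stronglyMeasurable (h.adapted n hn)).inner (h.adapted n hn)).measurable

theorem measurable_norm_noise (h : IsEnergyScheme P 𝒢 ν β k M B ξ X D) {n : ℕ} (hn : n ≤ M) :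
    Measurable[𝒢 n] fun ω => ‖B (X n ω)‖ ^ 2 :=
  (h.continuous_noise.comp_stronglyMeasurable (h.adapted n hn)).norm.measurable.pow_const 2

theorem measurable_energy (h : IsEnergyScheme P 𝒢 ν β k M B ξ X D) {n : ℕ} (hn : n ≤ M) :
    Measurable[𝒢 n] fun ω => 1 + ‖X n ω‖ ^ 2 :=
  ((h.adapted n hn).norm.measurable.pow_const 2).const_add 1

theorem one_sub_pos (h : IsEnergyScheme P 𝒢 ν β k M B ξ X D) : 0 < 1 - k / ν := by
  have h1 : (k : ℝ) / ν ≤ 1 / 2 := by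
    rw [div_le_iff₀ h.ν_pos]
    linarith [h.step_le]
  linarith

/-- For t = k/ν in [0, 1/2], (1 - t)(1 + 2t) = 1 + t(1 - 2t) ≥ 1. -/
theorem inv_one_sub_le (h : IsEnergyScheme P 𝒢 ν β k M B ξ X D) :
    (1 - k / ν)⁻¹ ≤ Real.exp (2 * (k / ν)) := by
  have h1 : (k : ℝ) / ν ≤ 1 / 2 := by
    rw [div_le_iff₀ h.ν_pos]
    linarith [h.step_le]
  have h2 : 0 ≤ (k : ℝ) / ν := div_nonneg k.coe_nonneg h.ν_pos.le
  rw [inv_le_iff_one_le_mul₀ h.one_sub_pos]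
  have h3 := Real.add_one_le_exp (2 * ((k : ℝ) / ν))
  nlinarith [h.one_sub_pos]

/-- Cauchy-Schwarz with linear growth supplies the hypothesis γ² ≤ β of the Gaussian estimate. -/
theorem sq_inner_div_le (h : IsEnergyScheme P 𝒢 ν β k M B ξ X D) (x : H) :
    (inner ℝ (B x) x / (1 + ‖x‖ ^ 2)) ^ 2 ≤ β := by
  have hA : 0 < 1 + ‖x‖ ^ 2 := by positivity
  rw [div_pow, div_le_iff₀ (by positivity)]
  have h1 : (inner ℝ (B x) x : ℝ) ^ 2 ≤ ‖B x‖ ^ 2 * ‖x‖ ^ 2 := by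
    rw [← mul_pow]
    exact sq_le_sq' (neg_le_of_abs_le (abs_real_inner_le_norm _ _)) (real_inner_le_norm _ _)
  have h2 := h.growth x
  calc (inner ℝ (B x) x : ℝ) ^ 2 ≤ ‖B x‖ ^ 2 * ‖x‖ ^ 2 := h1
    _ ≤ (β * (1 + ‖x‖ ^ 2)) * (1 + ‖x‖ ^ 2) := by
        have h3 := mul_nonneg h.β_nonneg hA.le
        gcongr
        linarith
    _ = β * (1 + ‖x‖ ^ 2) ^ 2 := by ring

/-- The dissipation is dropped and 1 is added, so that the noise becomes a multiplicative
perturbation of the energy. -/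
theorem energy_le (h : IsEnergyScheme P 𝒢 ν β k M B ξ X D) :
    ∀ᵐ ω ∂P, ∀ n < M, 1 + ‖X (n + 1) ω‖ ^ 2 ≤ (1 - k / ν)⁻¹ * ((1 + ‖X n ω‖ ^ 2) *
      (1 + 2 * (inner ℝ (B (X n ω)) (X n ω) / (1 + ‖X n ω‖ ^ 2)) * ξ n ω + β * ξ n ω ^ 2)) := by
  filter_upwards [h.energy] with ω hω n hn
  rw [← div_eq_inv_mul, le_div_iff₀ h.one_sub_pos]
  have hA : 0 < 1 + ‖X n ω‖ ^ 2 := by positivity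
  have e : (1 + ‖X n ω‖ ^ 2) *
      (1 + 2 * (inner ℝ (B (X n ω)) (X n ω) / (1 + ‖X n ω‖ ^ 2)) * ξ n ω + β * ξ n ω ^ 2)
      = 1 + ‖X n ω‖ ^ 2 + 2 * inner ℝ (B (X n ω)) (X n ω) * ξ n ω
        + β * (1 + ‖X n ω‖ ^ 2) * ξ n ω ^ 2 := by
    field_simp
  rw [e]
  have h1 := mul_le_mul_of_nonneg_right (h.growth (X n ω)) (sq_nonneg (ξ n ω))
  have h2 := mul_nonneg (mul_nonneg h.ν_pos.le k.coe_nonneg) (h.dissipation_nonneg (n + 1) ω)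
  have h3 : 0 ≤ (k : ℝ) / ν := div_nonneg k.coe_nonneg h.ν_pos.le
  have h4 := hω n hn
  linarith

/-- The ratio of the energy after `n` steps to the initial energy. -/
def ratio (X : ℕ → Ω → H) (n : ℕ) (ω : Ω) : ℝ := (1 + ‖X n ω‖ ^ 2) / (1 + ‖X 0 ω‖ ^ 2)

theorem measurable_ratio (h : IsEnergyScheme P 𝒢 ν β k M B ξ X D) {n : ℕ} (hn : n ≤ M) :
    Measurable[𝒢 n] (ratio X n) :=
  (h.measurable_energy hn).div
    ((h.measurable_energy (Nat.zero_le M)).mono (𝒢.mono (Nat.zero_le n)) le_rfl)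

/-- The arbitrary weight `g` plays the role of conditioning on 𝒢 n: the increment is integrated out
with γ frozen, which leaves a deterministic factor. -/
theorem lintegral_ratio_step [IsProbabilityMeasure P]
    (h : IsEnergyScheme P 𝒢 ν β k M B ξ X D) {n : ℕ} (hn : n < M) {g : Ω → ℝ≥0∞}
    (hg : Measurable[𝒢 n] g) :
    ∫⁻ ω, g ω * ENNReal.ofReal (ratio X (n + 1) ω ^ 5) ∂P
      ≤ ENNReal.ofReal (Real.exp (growthRate ν β * k))
        * ∫⁻ ω, g ω * ENNReal.ofReal (ratio X n ω ^ 5) ∂P := by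
  let γ : Ω → ℝ := fun ω => inner ℝ (B (X n ω)) (X n ω) / (1 + ‖X n ω‖ ^ 2)
  have hγ : Measurable[𝒢 n] γ := (h.measurable_inner hn.le).div (h.measurable_energy hn.le)
  let F : ℝ → ℝ → ℝ≥0∞ := fun y x => ENNReal.ofReal ((1 + 2 * y * x + β * x ^ 2) ^ 5)
  have hF : Measurable (Function.uncurry F) := by
    simp only [F, Function.uncurry_def]
    fun_prop
  let c : ℝ≥0∞ := ENNReal.ofReal ((1 - k / ν)⁻¹ ^ 5)
  have hg' : Measurable[𝒢 n] fun ω => c * (g ω * ENNReal.ofReal (ratio X n ω ^ 5)) :=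
    (hg.mul ((h.measurable_ratio hn.le).pow_const 5).ennreal_ofReal).const_mul c
  have hinv : 0 ≤ (1 - k / ν)⁻¹ := inv_nonneg.2 h.one_sub_pos.le
  have hpt : ∀ᵐ ω ∂P, g ω * ENNReal.ofReal (ratio X (n + 1) ω ^ 5)
      ≤ c * (g ω * ENNReal.ofReal (ratio X n ω ^ 5)) * F (γ ω) (ξ n ω) := by
    filter_upwards [h.energy_le] with ω hω
    have h1 := div_le_div_of_nonneg_right (hω n hn)
      (by positivity : (0 : ℝ) ≤ 1 + ‖X 0 ω‖ ^ 2)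
    have hr0 : 0 ≤ ratio X n ω := by unfold ratio; positivity
    have h2 : ratio X (n + 1) ω
        ≤ (1 - k / ν)⁻¹ * (ratio X n ω * (1 + 2 * γ ω * ξ n ω + β * ξ n ω ^ 2)) := by
      refine h1.trans (le_of_eq ?_)
      simp only [ratio, γ]
      ring
    have h3 : ENNReal.ofReal (ratio X (n + 1) ω ^ 5)
        ≤ c * (ENNReal.ofReal (ratio X n ω ^ 5) * F (γ ω) (ξ n ω)) := by
      rw [← ENNReal.ofReal_mul (by positivity), ← ENNReal.ofReal_mul (by positivity),
        ← mul_pow, ← mul_pow]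
      refine ENNReal.ofReal_le_ofReal (pow_le_pow_left₀ ?_ h2 5)
      unfold ratio
      positivity
    calc g ω * ENNReal.ofReal (ratio X (n + 1) ω ^ 5)
        ≤ g ω * (c * (ENNReal.ofReal (ratio X n ω ^ 5) * F (γ ω) (ξ n ω))) :=
          mul_le_mul_right h3 _
      _ = _ := by ring
  have h1 := lintegral_mul_le_of_indep (𝒢.le n) (h.law n) (h.indep n) hg' hγ hF
    (fun ω => lintegral_gaussian_pow_five_le (h.sq_inner_div_le (X n ω)) k)
  refine (lintegral_mono_ae hpt).trans (h1.trans ?_)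
  rw [lintegral_const_mul (f := fun ω => g ω * ENNReal.ofReal (ratio X n ω ^ 5)) _ ((hg.mul
    ((h.measurable_ratio hn.le).pow_const 5).ennreal_ofReal).mono (𝒢.le n) le_rfl), ← mul_assoc]
  refine mul_le_mul_left ?_ _
  rw [← ENNReal.ofReal_mul (Real.exp_pos _).le]
  refine ENNReal.ofReal_le_ofReal ?_
  have e1 : (1 - k / ν)⁻¹ ^ 5 ≤ Real.exp (2 * (k / ν)) ^ 5 :=
    pow_le_pow_left₀ hinv h.inv_one_sub_le 5
  -- Since k ≤ ν/2, the rate no longer depends on the step size.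
  have e2 : noiseRate β k * k ≤ noiseRate β (ν / 2) * k :=
    mul_le_mul_of_nonneg_right (noiseRate_mono h.β_nonneg k.coe_nonneg h.step_le) k.coe_nonneg
  calc Real.exp (noiseRate β k * k) * (1 - k / ν)⁻¹ ^ 5
      ≤ Real.exp (noiseRate β (ν / 2) * k) * Real.exp (2 * (k / ν)) ^ 5 := by gcongr
    _ = Real.exp (growthRate ν β * k) := by
        rw [← Real.exp_nat_mul, ← Real.exp_add, growthRate]
        congr 1
        push_cast
        ring

theorem growthRate_nonneg (h : IsEnergyScheme P 𝒢 ν β k M B ξ X D) : 0 ≤ growthRate ν β :=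
  add_nonneg (div_nonneg (by norm_num) h.ν_pos.le) (noiseRate_nonneg h.β_nonneg)

/-- Moments of the running maximum in terms of the initial moments. -/
theorem lintegral_sup_le [IsProbabilityMeasure P]
    (h : IsEnergyScheme P 𝒢 ν β k M B ξ X D) {q : ℝ} (hq0 : 0 ≤ q) (hq8 : q ≤ 8) :
    ∫⁻ ω, (⨆ n ∈ Finset.Icc 0 M, ‖X n ω‖ₑ ^ q) ∂P
      ≤ ENNReal.ofReal (32 * Real.exp (growthRate ν β * (k * M)))
        * ∫⁻ ω, ENNReal.ofReal ((1 + ‖X 0 ω‖ ^ 2) ^ (q / 2)) ∂P := by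
  have hw : Measurable[𝒢 0] fun ω => ENNReal.ofReal ((1 + ‖X 0 ω‖ ^ 2) ^ (q / 2)) :=
    ((h.measurable_energy (Nat.zero_le M)).pow_const (q / 2)).ennreal_ofReal
  have hκ : 1 ≤ ENNReal.ofReal (Real.exp (growthRate ν β * k)) := by
    rw [ENNReal.one_le_ofReal]
    exact Real.one_le_exp (mul_nonneg h.growthRate_nonneg k.coe_nonneg)
  have hr0 : ∀ ω, ratio X 0 ω = 1 := fun ω =>
    div_self (by positivity : (0 : ℝ) < 1 + ‖X 0 ω‖ ^ 2).ne'
  have key := lintegral_sup_pow_four_le (P := P) (𝒢 := 𝒢) (ρ := ratio X) (M := M)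
    (fun n hn => h.measurable_ratio hn) hr0 (fun n ω => by unfold ratio; positivity) hκ
    (fun n hn g hg => h.lintegral_ratio_step hn hg) hw
  have e : ENNReal.ofReal (32 * Real.exp (growthRate ν β * (k * M)))
      = 32 * ENNReal.ofReal (Real.exp (growthRate ν β * k)) ^ M := by
    rw [ENNReal.ofReal_mul (by norm_num), ← ENNReal.ofReal_pow (Real.exp_pos _).le,
      ← Real.exp_nat_mul]
    congr 3
    · norm_num
    · ring
  rw [e]
  refine (lintegral_mono fun ω => iSup₂_le fun n hn => ?_).trans key
  -- The value 1 in the maximum is itself attained by the ratio, at index 0.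
  refine (enorm_rpow_le (X n ω) (X 0 ω) hq0 hq8).trans (mul_le_mul_right ?_ _)
  refine max_le ?_ (le_iSup₂ (f := fun n _ => ENNReal.ofReal (ratio X n ω ^ 4)) n hn)
  refine le_trans ?_ (le_iSup₂ (f := fun n _ => ENNReal.ofReal (ratio X n ω ^ 4)) 0 (by simp))
  simp [hr0]

theorem integrable_sq [IsProbabilityMeasure P] (h : IsEnergyScheme P 𝒢 ν β k M B ξ X D) {S : ℝ}
    (hS : ∫⁻ ω, (⨆ n ∈ Finset.Icc 0 M, ‖X n ω‖ₑ ^ (2 : ℝ)) ∂P ≤ ENNReal.ofReal S)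
    {n : ℕ} (hn : n ≤ M) :
    Integrable (fun ω => ‖X n ω‖ ^ 2) P ∧ ∫ ω, ‖X n ω‖ ^ 2 ∂P ≤ max S 0 := by
  have hm : AEStronglyMeasurable (fun ω => ‖X n ω‖ ^ 2) P :=
    (((h.adapted n hn).norm.measurable.pow_const 2).mono (𝒢.le n) le_rfl).aestronglyMeasurable
  have h1 : ∫⁻ ω, ENNReal.ofReal (‖X n ω‖ ^ 2) ∂P ≤ ENNReal.ofReal S := by
    refine (lintegral_mono fun ω => ?_).trans hS
    refine le_trans (le_of_eq ?_)
      (le_iSup₂ (f := fun n _ => ‖X n ω‖ₑ ^ (2 : ℝ)) n (Finset.mem_Icc.2 ⟨Nat.zero_le n, hn⟩))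
    rw [ENNReal.rpow_two, ENNReal.ofReal_pow (norm_nonneg _), ofReal_norm]
  have hpos : 0 ≤ᵐ[P] fun ω => ‖X n ω‖ ^ 2 := ae_of_all _ fun ω => sq_nonneg _
  refine ⟨⟨hm, ?_⟩, ?_⟩
  · rw [hasFiniteIntegral_iff_ofReal hpos]
    exact h1.trans_lt ENNReal.ofReal_lt_top
  · rw [integral_eq_lintegral_of_nonneg_ae hpos hm]
    exact ENNReal.toReal_le_of_le_ofReal (le_max_right _ _)
      (h1.trans (ENNReal.ofReal_le_ofReal (le_max_left _ _)))

/-- The expected dissipation in one step. -/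
theorem lintegral_dissipation_step_le [IsProbabilityMeasure P]
    (h : IsEnergyScheme P 𝒢 ν β k M B ξ X D)
    (hi : ∀ n ≤ M, Integrable (fun ω => ‖X n ω‖ ^ 2) P) {n : ℕ} (hn : n < M) :
    ∃ t, 0 ≤ t ∧ ∫⁻ ω, ENNReal.ofReal (ν * k * D (n + 1) ω) ∂P ≤ ENNReal.ofReal t ∧
      t ≤ (∫ ω, ‖X n ω‖ ^ 2 ∂P - (1 - k / ν) * ∫ ω, ‖X (n + 1) ω‖ ^ 2 ∂P
        + β * (1 + ∫ ω, ‖X n ω‖ ^ 2 ∂P) * (k * ∫ x : ℝ, x ^ 2 ∂(gaussianReal 0 1))) := by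
  have hξ2i : Integrable (fun ω => ξ n ω ^ 2) P := by
    have hi2 := integrable_pow_gaussianReal k 2
    rw [← (h.law n).map_eq] at hi2
    exact hi2.comp_aemeasurable (h.law n).aemeasurable
  have hξ1i : Integrable (ξ n) P := by
    have hi1 := integrable_pow_gaussianReal k 1
    simp only [pow_one] at hi1
    rw [← (h.law n).map_eq] at hi1
    exact hi1.comp_aemeasurable (h.law n).aemeasurable
  have hξ1 : ∫ ω, ξ n ω ∂P = 0 := by
    rw [(h.law n).integral_eq, integral_id_gaussianReal]
  have hξ2 : ∫ ω, ξ n ω ^ 2 ∂P = k * ∫ x : ℝ, x ^ 2 ∂(gaussianReal 0 1) := by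
    have := (h.law n).integral_comp (f := fun x : ℝ => x ^ 2) (by fun_prop)
    refine this.trans ?_
    rw [integral_pow_gaussianReal, Real.sq_sqrt k.coe_nonneg]
  have hmG := h.measurable_inner hn.le
  have hmN := h.measurable_norm_noise hn.le
  -- The state is 𝒢 n-measurable, hence independent of ξ n: the cross term has mean zero and the
  -- quadratic term factorizes.
  have hindG : IndepFun (fun ω => (inner ℝ (B (X n ω)) (X n ω) : ℝ)) (ξ n) P := by
    rw [IndepFun_iff_Indep]
    exact indep_of_indep_of_le_left (h.indep n).symm hmG.comap_le
  have hindN : IndepFun (fun ω => ‖B (X n ω)‖ ^ 2) (fun ω => ξ n ω ^ 2) P := by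
    have : IndepFun (fun ω => ‖B (X n ω)‖ ^ 2) (ξ n) P := by
      rw [IndepFun_iff_Indep]
      exact indep_of_indep_of_le_left (h.indep n).symm hmN.comap_le
    exact this.comp measurable_id (measurable_id.pow_const 2)
  have hβi : Integrable (fun ω => β * (1 + ‖X n ω‖ ^ 2)) P :=
    ((integrable_const 1).add (hi n hn.le)).const_mul β
  have hNi : Integrable (fun ω => ‖B (X n ω)‖ ^ 2) P := by
    refine hβi.mono' (hmN.mono (𝒢.le n) le_rfl).aestronglyMeasurable (ae_of_all _ fun ω => ?_)
    rw [Real.norm_of_nonneg (sq_nonneg _)]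
    exact h.growth _
  have hGi : Integrable (fun ω => (inner ℝ (B (X n ω)) (X n ω) : ℝ)) P := by
    refine (hNi.add (hi n hn.le)).mono' (hmG.mono (𝒢.le n) le_rfl).aestronglyMeasurable
      (ae_of_all _ fun ω => ?_)
    have h1 := abs_real_inner_le_norm (B (X n ω)) (X n ω)
    simp only [Pi.add_apply, Real.norm_eq_abs]
    nlinarith [sq_nonneg (‖B (X n ω)‖ - ‖X n ω‖), sq_nonneg (‖B (X n ω)‖ + ‖X n ω‖)]
  have hGξi : Integrable (fun ω => (inner ℝ (B (X n ω)) (X n ω) : ℝ) * ξ n ω) P :=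
    hindG.integrable_mul hGi hξ1i
  have hNξi : Integrable (fun ω => ‖B (X n ω)‖ ^ 2 * ξ n ω ^ 2) P :=
    hindN.integrable_mul hNi hξ2i
  have hGξ : ∫ ω, (inner ℝ (B (X n ω)) (X n ω) : ℝ) * ξ n ω ∂P = 0 := by
    have := hindG.integral_mul_eq_mul_integral hGi.aestronglyMeasurable hξ1i.aestronglyMeasurable
    rw [hξ1, mul_zero] at this
    exact this
  have hNξ : ∫ ω, ‖B (X n ω)‖ ^ 2 * ξ n ω ^ 2 ∂P
      = (∫ ω, ‖B (X n ω)‖ ^ 2 ∂P) * (k * ∫ x : ℝ, x ^ 2 ∂(gaussianReal 0 1)) := by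
    have := hindN.integral_mul_eq_mul_integral hNi.aestronglyMeasurable hξ2i.aestronglyMeasurable
    rw [hξ2] at this
    exact this
  have hN : ∫ ω, ‖B (X n ω)‖ ^ 2 ∂P ≤ β * (1 + ∫ ω, ‖X n ω‖ ^ 2 ∂P) := by
    refine (integral_mono hNi hβi fun ω => h.growth _).trans (le_of_eq ?_)
    rw [integral_const_mul, integral_add (integrable_const 1) (hi n hn.le)]
    simp
  have i1 : Integrable (fun ω => ‖X n ω‖ ^ 2 - (1 - k / ν) * ‖X (n + 1) ω‖ ^ 2) P :=
    (hi n hn.le).sub ((hi (n + 1) hn).const_mul _)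
  have i2 : Integrable (fun ω => ‖X n ω‖ ^ 2 - (1 - k / ν) * ‖X (n + 1) ω‖ ^ 2
      + 2 * ((inner ℝ (B (X n ω)) (X n ω) : ℝ) * ξ n ω)) P := i1.add (hGξi.const_mul 2)
  have i3 : Integrable (fun ω => ‖X n ω‖ ^ 2 - (1 - k / ν) * ‖X (n + 1) ω‖ ^ 2
      + 2 * ((inner ℝ (B (X n ω)) (X n ω) : ℝ) * ξ n ω) + ‖B (X n ω)‖ ^ 2 * ξ n ω ^ 2) P :=
    i2.add hNξi
  have hle : ∀ᵐ ω ∂P, ν * k * D (n + 1) ω ≤ ‖X n ω‖ ^ 2 - (1 - k / ν) * ‖X (n + 1) ω‖ ^ 2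
      + 2 * ((inner ℝ (B (X n ω)) (X n ω) : ℝ) * ξ n ω) + ‖B (X n ω)‖ ^ 2 * ξ n ω ^ 2 := by
    filter_upwards [h.energy] with ω hω
    have := hω n hn
    linarith
  have hpos : ∀ᵐ ω ∂P, 0 ≤ ‖X n ω‖ ^ 2 - (1 - k / ν) * ‖X (n + 1) ω‖ ^ 2
      + 2 * ((inner ℝ (B (X n ω)) (X n ω) : ℝ) * ξ n ω) + ‖B (X n ω)‖ ^ 2 * ξ n ω ^ 2 := by
    filter_upwards [hle] with ω hω
    exact (mul_nonneg (mul_nonneg h.ν_pos.le k.coe_nonneg) (h.dissipation_nonneg (n + 1) ω)).trans hω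
  -- The witness t is the expectation of the upper bound for the dissipation. D carries no
  -- measurability, so its own integral stays a lower Lebesgue integral.
  refine ⟨_, integral_nonneg_of_ae hpos,
    (lintegral_mono_ae (hle.mono fun ω hω => ENNReal.ofReal_le_ofReal hω)).trans_eq
      (ofReal_integral_eq_lintegral_ofReal i3 hpos).symm, ?_⟩
  rw [integral_add i2 hNξi, integral_add i1 (hGξi.const_mul 2),
    integral_sub (hi n hn.le) ((hi (n + 1) hn).const_mul _), integral_const_mul,
    integral_const_mul, hGξ, hNξ, mul_zero, add_zero]
  have hm2 : 0 ≤ k * ∫ x : ℝ, x ^ 2 ∂(gaussianReal 0 1) :=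
    mul_nonneg k.coe_nonneg (integral_nonneg fun x => sq_nonneg x)
  gcongr

/-- The total expected dissipation. -/
theorem sum_dissipation_le [IsProbabilityMeasure P] (h : IsEnergyScheme P 𝒢 ν β k M B ξ X D)
    {S : ℝ} (hS0 : 0 ≤ S)
    (hS : ∫⁻ ω, (⨆ n ∈ Finset.Icc 0 M, ‖X n ω‖ₑ ^ (2 : ℝ)) ∂P ≤ ENNReal.ofReal S) :
    ENNReal.ofReal k * ∑ n ∈ Finset.Icc 1 M, ∫⁻ ω, ENNReal.ofReal (D n ω) ∂P
      ≤ ENNReal.ofReal (ν⁻¹ * (S + k * M * (S / ν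
        + β * (1 + S) * ∫ x : ℝ, x ^ 2 ∂(gaussianReal 0 1)))) := by
  set m₂ := ∫ x : ℝ, x ^ 2 ∂(gaussianReal 0 1)
  have hm2 : 0 ≤ m₂ := integral_nonneg fun x => sq_nonneg x
  have hi : ∀ n ≤ M, Integrable (fun ω => ‖X n ω‖ ^ 2) P := fun n hn => (h.integrable_sq hS hn).1
  have hb : ∀ n ≤ M, ∫ ω, ‖X n ω‖ ^ 2 ∂P ≤ S := fun n hn => by
    have := (h.integrable_sq hS hn).2
    rwa [max_eq_left hS0] at this
  have hβ := h.β_nonneg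
  have hν := h.ν_pos
  have hk : (0 : ℝ) ≤ k := k.coe_nonneg
  obtain ⟨a, ha⟩ : ∃ a : ℕ → ℝ, ∀ n, a n = ∫ ω, ‖X n ω‖ ^ 2 ∂P := ⟨_, fun _ => rfl⟩
  have ha0 : ∀ n, 0 ≤ a n := fun n => by
    rw [ha]
    exact integral_nonneg fun ω => sq_nonneg _
  simp_rw [← ha] at hb
  set c := k * (S / ν + β * (1 + S) * m₂) with hc
  -- Telescoping; c bounds the per-step gain from anti-diffusion and noise. Nonnegativity is carried
  -- along because `ENNReal.ofReal` is additive only on nonnegative reals.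
  have key : ∀ N ≤ M, 0 ≤ a 0 - a N + N * c ∧
      ∑ n ∈ Finset.range N, ∫⁻ ω, ENNReal.ofReal (ν * k * D (n + 1) ω) ∂P
        ≤ ENNReal.ofReal (a 0 - a N + N * c) := by
    intro N
    induction N with
    | zero => simp
    | succ N ih =>
      intro hN
      obtain ⟨hpos, hsum⟩ := ih (by omega)
      obtain ⟨t, ht0, ht, htle⟩ := h.lintegral_dissipation_step_le hi (n := N) (by omega)
      rw [← ha, ← ha] at htle
      have h1 : k / ν * a (N + 1) ≤ k * (S / ν) := by
        rw [div_mul_eq_mul_div, mul_div_assoc]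
        gcongr
        exact hb _ hN
      have h2 : β * (1 + a N) * (k * m₂) ≤ β * (1 + S) * (k * m₂) := by
        gcongr
        exact hb _ (by omega)
      have h3 : a 0 - a N + N * c + t ≤ a 0 - a (N + 1) + (N + 1 : ℕ) * c := by
        have e : c = k * (S / ν) + β * (1 + S) * (k * m₂) := by rw [hc]; ring
        push_cast
        linarith
      refine ⟨(add_nonneg hpos ht0).trans h3, ?_⟩
      rw [Finset.sum_range_succ]
      refine (add_le_add hsum ht).trans ?_
      rw [← ENNReal.ofReal_add hpos ht0]
      exact ENNReal.ofReal_le_ofReal h3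
  obtain ⟨hpos, hsum⟩ := key M le_rfl
  have e1 : ∀ n ω, ENNReal.ofReal k * ENNReal.ofReal (D n ω)
      = ENNReal.ofReal ν⁻¹ * ENNReal.ofReal (ν * k * D n ω) := fun n ω => by
    rw [← ENNReal.ofReal_mul hk, ← ENNReal.ofReal_mul (inv_nonneg.2 hν.le)]
    congr 1
    field_simp
  have e2 : ∑ n ∈ Finset.Icc 1 M, ∫⁻ ω, ENNReal.ofReal (D n ω) ∂P
      = ∑ n ∈ Finset.range M, ∫⁻ ω, ENNReal.ofReal (D (n + 1) ω) ∂P := by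
    rw [Finset.range_eq_Ico, Finset.sum_Ico_add' (fun n => ∫⁻ ω, ENNReal.ofReal (D n ω) ∂P)]
    rfl
  rw [e2, Finset.mul_sum, ENNReal.ofReal_mul (inv_nonneg.2 hν.le)]
  calc ∑ n ∈ Finset.range M, ENNReal.ofReal k * ∫⁻ ω, ENNReal.ofReal (D (n + 1) ω) ∂P
      = ENNReal.ofReal ν⁻¹ *
          ∑ n ∈ Finset.range M, ∫⁻ ω, ENNReal.ofReal (ν * k * D (n + 1) ω) ∂P := by
        rw [Finset.mul_sum]
        refine Finset.sum_congr rfl fun n _ => ?_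
        rw [← lintegral_const_mul' _ _ ENNReal.ofReal_ne_top,
          ← lintegral_const_mul' _ _ ENNReal.ofReal_ne_top]
        simp_rw [e1]
    _ ≤ _ := by
        refine mul_le_mul_right (hsum.trans (ENNReal.ofReal_le_ofReal ?_)) _
        have := hb 0 (Nat.zero_le M)
        have e3 : M * c = k * M * (S / ν + β * (1 + S) * m₂) := by rw [hc]; ring
        linarith [ha0 M]

end IsEnergyScheme

end EnergyScheme

end SKS

end

noncomputable section

namespace SKS

/-! ### The discrete scheme as an energy scheme -/

section Scheme

theorem LipschitzNoise.continuous {L : ℝ} {B : L2D L → L2D L} {cB : ℝ}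
    (hB : LipschitzNoise B cB) : Continuous B := by
  obtain ⟨CB, hB, hle⟩ := hB
  have hcB : 0 ≤ cB := (norm_nonneg _).trans ((le_max_right _ _).trans hle)
  refine (LipschitzWith.of_dist_le_mul (K := ⟨cB, hcB⟩) fun v w => ?_).continuous
  rw [dist_eq_norm, dist_eq_norm]
  exact (hB v w).trans
    (mul_le_mul_of_nonneg_right ((le_max_left _ _).trans hle) (norm_nonneg _))

theorem LipschitzNoise.growth {L : ℝ} {B : L2D L → L2D L} {cB : ℝ}
    (hB : LipschitzNoise B cB) (x : L2D L) : ‖B x‖ ^ 2 ≤ 2 * cB ^ 2 * (1 + ‖x‖ ^ 2) := by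
  obtain ⟨CB, hB, hle⟩ := hB
  have h0 : ‖B 0‖ ≤ cB := (le_max_right _ _).trans hle
  have hcB : 0 ≤ cB := (norm_nonneg _).trans h0
  have h1 : ‖B x - B 0‖ ≤ cB * ‖x‖ := by
    have := hB x 0
    rw [sub_zero] at this
    exact this.trans (mul_le_mul_of_nonneg_right ((le_max_left _ _).trans hle) (norm_nonneg _))
  have h2 : ‖B x‖ ≤ cB * (1 + ‖x‖) := by
    have := norm_add_le (B x - B 0) (B 0)
    rw [sub_add_cancel] at this
    linarith
  calc ‖B x‖ ^ 2 ≤ (cB * (1 + ‖x‖)) ^ 2 := pow_le_pow_left₀ (norm_nonneg _) h2 2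
    _ ≤ 2 * cB ^ 2 * (1 + ‖x‖ ^ 2) := by
        nlinarith [mul_nonneg (sq_nonneg cB) (sq_nonneg (1 - ‖x‖))]

variable {Ω : Type*} {mΩ : MeasurableSpace Ω} {P : Measure Ω} {ℱ : Filtration ℝ≥0 mΩ}
  {W : ℝ≥0 → Ω → ℝ} {L ν : ℝ} {B : L2D L → L2D L} {u₀ : Ω → L2D L} {T : ℝ≥0} {M : ℕ}
  {mesh : Mesh L} {r : ℕ} {u : ℕ → Ω → Vh mesh r}

/-- The filtration of a continuous time filtration observed on the time grid of width `k`. -/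
def gridFiltration (ℱ : Filtration ℝ≥0 mΩ) (k : ℝ≥0) : Filtration ℕ mΩ where
  seq n := ℱ (n * k)
  mono' := fun _ _ hmn => ℱ.mono (mul_le_mul_left (Nat.cast_le.2 hmn) k)
  le' := fun n => ℱ.le (n * k)

theorem IsWienerProcess.hasLaw_increment (hW : IsWienerProcess P ℱ W) (k : ℝ≥0) (n : ℕ) :
    HasLaw (fun ω => W ((n + 1 : ℕ) * k) ω - W (n * k) ω) (gaussianReal 0 k) P := by
  have h := hW.brownian.toIsPreBrownianReal.hasLaw_sub ((n + 1 : ℕ) * k) (n * k)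
  have e : nndist (((n + 1 : ℕ) * k : ℝ≥0) : ℝ) ((n * k : ℝ≥0) : ℝ) = k := by
    ext
    rw [coe_nndist, Real.dist_eq]
    push_cast
    rw [show ((n : ℝ) + 1) * k - n * k = k by ring, abs_of_nonneg k.coe_nonneg]
  have h' : HasLaw (W ((n + 1 : ℕ) * k) - W (n * k)) (gaussianReal 0 k) P := by
    convert! h using 2
    exact e.symm
  exact h'

theorem IsDiscreteSolution.isEnergyScheme {cB : ℝ} (hν : 0 < ν) (hL : 0 < L)
    (hB : LipschitzNoise B cB) (hW : IsWienerProcess P ℱ W) (hr : 4 ≤ r)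
    (hk : (T / M : ℝ) ≤ ν / 2) (hu : IsDiscreteSolution P ℱ W ν B u₀ T M u) :
    IsEnergyScheme P (gridFiltration ℱ (T / M)) ν (2 * cB ^ 2) (T / M) M B
      (fun n ω => W ((n + 1 : ℕ) * (T / M)) ω - W (n * (T / M)) ω) (fun n ω => toL2 (u n ω))
      (fun n ω => ip L (deriv (deriv (u n ω : ℝ → ℝ))) (deriv (deriv (u n ω : ℝ → ℝ)))) where
  ν_pos := hν
  step_le := by push_cast; exact hk
  continuous_noise := hB.continuous
  growth := hB.growth
  adapted := hu.adapted
  law := hW.hasLaw_increment (T / M)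
  indep := fun n => hW.indep _ _ (mul_le_mul_left (Nat.cast_le.2 n.le_succ) (T / M))
  dissipation_nonneg := fun n ω => integral_nonneg fun x => mul_self_nonneg _
  energy := by
    filter_upwards [hu.step] with ω hω n hn
    -- The test function is random, which is allowed since the scheme holds almost surely for all φ
    -- at once.
    have h := hω n hn (u (n + 1) ω)
    simp only [NNReal.coe_div, NNReal.coe_natCast]
    exact energy_step hL hr hν (div_nonneg T.coe_nonneg (Nat.cast_nonneg M)) (u n ω)
      (u (n + 1) ω) _ h

/-- The L²-projection does not increase the norm, and (1 + x²)^{q/2} ≤ (1 + x)^q ≤ 2^q (1 + x^q) for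
x ≥ 0. -/
theorem IsDiscreteSolution.lintegral_initial_le [IsProbabilityMeasure P]
    (hu : IsDiscreteSolution P ℱ W ν B u₀ T M u) {q : ℝ} (hq : 0 < q) {K : ℝ≥0}
    (hK : eLpNorm u₀ (ENNReal.ofReal q) P ≤ K) :
    ∫⁻ ω, ENNReal.ofReal ((1 + ‖toL2 (u 0 ω)‖ ^ 2) ^ (q / 2)) ∂P
      ≤ ENNReal.ofReal (2 ^ q * (1 + K ^ q)) := by
  have hpt : ∀ᵐ ω ∂P, ENNReal.ofReal ((1 + ‖toL2 (u 0 ω)‖ ^ 2) ^ (q / 2))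
      ≤ ENNReal.ofReal (2 ^ q) * (1 + ‖u₀ ω‖ₑ ^ q) := by
    filter_upwards [hu.initial] with ω hω
    have h1 := norm_projection_le (hω (u 0 ω))
    set x := ‖u₀ ω‖ with hx
    have hx0 : 0 ≤ x := norm_nonneg _
    have h2 : (1 + ‖toL2 (u 0 ω)‖ ^ 2) ^ (q / 2) ≤ (1 + x) ^ q := by
      calc (1 + ‖toL2 (u 0 ω)‖ ^ 2) ^ (q / 2) ≤ ((1 + x) ^ 2) ^ (q / 2) := by
            have := pow_le_pow_left₀ (norm_nonneg _) h1 2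
            refine Real.rpow_le_rpow (by positivity) ?_ (by positivity)
            nlinarith
        _ = (1 + x) ^ q := by
            rw [← Real.rpow_natCast, ← Real.rpow_mul (by positivity)]
            congr 1
            push_cast
            ring
    have h3 : (1 + x) ^ q ≤ 2 ^ q * (1 + x ^ q) := by
      have hxq : 0 ≤ x ^ q := Real.rpow_nonneg hx0 q
      have h2q : (0 : ℝ) ≤ 2 ^ q := by positivity
      rcases le_total x 1 with h | h
      · have := Real.rpow_le_rpow (by positivity) (by linarith : 1 + x ≤ 2) hq.le
        nlinarith
      · have := Real.rpow_le_rpow (by positivity) (by linarith : 1 + x ≤ 2 * x) hq.le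
        rw [Real.mul_rpow (by norm_num) hx0] at this
        nlinarith
    refine (ENNReal.ofReal_le_ofReal (h2.trans h3)).trans (le_of_eq ?_)
    rw [ENNReal.ofReal_mul (by positivity), ENNReal.ofReal_add zero_le_one (by positivity),
      ENNReal.ofReal_one, ← ENNReal.ofReal_rpow_of_nonneg hx0 hq.le, hx, ofReal_norm]
  refine (lintegral_mono_ae hpt).trans ?_
  have hKq : ∫⁻ ω, ‖u₀ ω‖ₑ ^ q ∂P ≤ ENNReal.ofReal (K ^ q) := by
    rw [eLpNorm_eq_lintegral_rpow_enorm_toReal (by simpa using hq) ENNReal.ofReal_ne_top,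
      ENNReal.toReal_ofReal hq.le] at hK
    have h := ENNReal.rpow_le_rpow hK hq.le
    rw [← ENNReal.rpow_mul, one_div, inv_mul_cancel₀ hq.ne', ENNReal.rpow_one] at h
    rwa [← ENNReal.ofReal_rpow_of_nonneg K.coe_nonneg hq.le, ENNReal.ofReal_coe_nnreal]
  rw [lintegral_const_mul' _ _ ENNReal.ofReal_ne_top, lintegral_add_left measurable_const,
    ENNReal.ofReal_mul (by positivity), ENNReal.ofReal_add zero_le_one (by positivity),
    lintegral_const, measure_univ, mul_one, ENNReal.ofReal_one]
  gcongr

/-- The bound for the moment of order `q` of the running maximum. -/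
def momentBound (ν cB T K q : ℝ) : ℝ :=
  32 * Real.exp (growthRate ν (2 * cB ^ 2) * T) * (2 ^ q * (1 + K ^ q))

theorem momentBound_pos (ν cB T : ℝ) (K : ℝ≥0) (q : ℝ) : 0 < momentBound ν cB T K q := by
  unfold momentBound
  positivity

theorem IsDiscreteSolution.lintegral_sup_le [IsProbabilityMeasure P] {cB : ℝ} (hν : 0 < ν)
    (hL : 0 < L) (hB : LipschitzNoise B cB) (hW : IsWienerProcess P ℱ W) (hr : 4 ≤ r)
    (hM : 0 < M) (hk : (T / M : ℝ) ≤ ν / 2) (hu : IsDiscreteSolution P ℱ W ν B u₀ T M u)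
    {q : ℝ} (hq : 0 < q) (hq8 : q ≤ 8) {K : ℝ≥0}
    (hK : eLpNorm u₀ (ENNReal.ofReal q) P ≤ K) :
    ∫⁻ ω, (⨆ n ∈ Finset.Icc 0 M, ‖toL2 (u n ω)‖ₑ ^ q) ∂P
      ≤ ENNReal.ofReal (momentBound ν cB T K q) := by
  have h := (hu.isEnergyScheme hν hL hB hW hr hk).lintegral_sup_le hq.le hq8
  have hMT : ((T / M : ℝ≥0) : ℝ) * M = T := by
    push_cast
    exact div_mul_cancel₀ _ (by positivity)
  rw [hMT] at h
  refine h.trans ((mul_le_mul_right (hu.lintegral_initial_le hq hK) _).trans (le_of_eq ?_))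
  rw [← ENNReal.ofReal_mul (by positivity), momentBound]

theorem iSup_nrm_le (u : ℕ → Ω → Vh mesh r) (q : ℝ) (ω : Ω) :
    (⨆ n ∈ Finset.Icc 1 M, nrm L (u n ω) ^ q) ≤ ⨆ n ∈ Finset.Icc 0 M, ‖toL2 (u n ω)‖ₑ ^ q := by
  refine iSup₂_le fun n hn => ?_
  rw [nrm_eq_enorm]
  exact le_iSup₂ (f := fun n _ => ‖toL2 (u n ω)‖ₑ ^ q) n
    (Finset.mem_Icc.2 ⟨Nat.zero_le n, (Finset.mem_Icc.1 hn).2⟩)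

end Scheme

end SKS

end

/-! ### The main theorem -/

theorem mainTheorem8 (ν : ℝ) (hν : 0 < ν) :
    ∃ k₀ : ℝ, 0 < k₀ ∧ ∀ (T : ℝ≥0), 0 < T → ∀ (cB : ℝ) (K : ℝ≥0),
      -- second moments
      (∃ C₁ : ℝ, 0 < C₁ ∧
        ∀ (L : ℝ), 0 < L → ∀ (B : SKS.L2D L → SKS.L2D L), SKS.LipschitzNoise B cB →
        ∀ (Ω : Type*) (mΩ : MeasurableSpace Ω) (P : Measure Ω) [IsProbabilityMeasure P]
          (ℱ : Filtration ℝ≥0 mΩ) (W : ℝ≥0 → Ω → ℝ), SKS.IsWienerProcess P ℱ W →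
        ∀ (u₀ : Ω → SKS.L2D L), MemLp u₀ 2 P → eLpNorm u₀ 2 P ≤ K →
        ∀ (mesh : SKS.Mesh L) (r : ℕ), 4 ≤ r →
        ∀ (M : ℕ), 0 < M → (T / M : ℝ) ≤ k₀ →
        ∀ (u : ℕ → Ω → SKS.Vh mesh r), SKS.IsDiscreteSolution P ℱ W ν B u₀ T M u →
          ∫⁻ ω, (⨆ n ∈ Finset.Icc 1 M, SKS.nrm L (u n ω) ^ 2) ∂P
            + ENNReal.ofReal (T / M) * ∑ n ∈ Finset.Icc 1 M,
                ∫⁻ ω, SKS.nrm L (deriv (deriv (u n ω : ℝ → ℝ))) ^ 2 ∂P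
          ≤ ENNReal.ofReal C₁) ∧
      -- moments of order `2 ^ p`
      (∀ p : ℝ, 0 ≤ p → p ≤ 3 → ∃ Cp : ℝ, 0 < Cp ∧
        ∀ (L : ℝ), 0 < L → ∀ (B : SKS.L2D L → SKS.L2D L), SKS.LipschitzNoise B cB →
        ∀ (Ω : Type*) (mΩ : MeasurableSpace Ω) (P : Measure Ω) [IsProbabilityMeasure P]
          (ℱ : Filtration ℝ≥0 mΩ) (W : ℝ≥0 → Ω → ℝ), SKS.IsWienerProcess P ℱ W →
        ∀ (u₀ : Ω → SKS.L2D L), MemLp u₀ (ENNReal.ofReal (2 ^ p)) P →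
          eLpNorm u₀ (ENNReal.ofReal (2 ^ p)) P ≤ K →
        ∀ (mesh : SKS.Mesh L) (r : ℕ), 4 ≤ r →
        ∀ (M : ℕ), 0 < M → (T / M : ℝ) ≤ k₀ →
        ∀ (u : ℕ → Ω → SKS.Vh mesh r), SKS.IsDiscreteSolution P ℱ W ν B u₀ T M u →
          ∫⁻ ω, (⨆ n ∈ Finset.Icc 1 M, SKS.nrm L (u n ω) ^ ((2 : ℝ) ^ p)) ∂P
          ≤ ENNReal.ofReal Cp) := by
  -- With k₀ = ν/2 the factor 1 - k/ν is at least 1/2.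
  refine ⟨ν / 2, half_pos hν, fun T hT cB K => ⟨?_, fun p hp0 hp3 => ?_⟩⟩
  · set S := SKS.momentBound ν cB T K 2
    have hS : 0 < S := SKS.momentBound_pos ν cB T K 2
    have hm2 : 0 ≤ ∫ x : ℝ, x ^ 2 ∂(gaussianReal 0 1) := integral_nonneg fun x => sq_nonneg x
    -- The supremum contributes S; the rest is the total dissipation bound with kM = T and β = 2
    -- cB².
    refine ⟨S + ν⁻¹ * (S + T * (S / ν
      + 2 * cB ^ 2 * (1 + S) * ∫ x : ℝ, x ^ 2 ∂(gaussianReal 0 1))), by positivity, ?_⟩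
    intro L hL B hB Ω mΩ P _ ℱ W hW u₀ _ hK mesh r hr M hM hk u hu
    have h1 : ∫⁻ ω, (⨆ n ∈ Finset.Icc 0 M, ‖SKS.toL2 (u n ω)‖ₑ ^ (2 : ℝ)) ∂P
        ≤ ENNReal.ofReal S :=
      hu.lintegral_sup_le hν hL hB hW hr hM hk two_pos (by norm_num) (by simpa using hK)
    have h2 := (hu.isEnergyScheme hν hL hB hW hr hk).sum_dissipation_le hS.le h1
    have hMT : ((T / M : ℝ≥0) : ℝ) * M = T := by
      push_cast
      exact div_mul_cancel₀ _ (by positivity)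
    rw [hMT] at h2
    rw [ENNReal.ofReal_add hS.le (by positivity)]
    refine add_le_add ((lintegral_mono fun ω => ?_).trans h1) (le_trans (le_of_eq ?_) h2)
    · simpa only [ENNReal.rpow_two] using SKS.iSup_nrm_le (M := M) u 2 ω
    · push_cast
      simp_rw [SKS.nrm_sq_eq_ofReal (SKS.Vh_memLp_deriv_deriv _)]
  · refine ⟨SKS.momentBound ν cB T K (2 ^ p), SKS.momentBound_pos _ _ _ _ _, ?_⟩
    intro L hL B hB Ω mΩ P _ ℱ W hW u₀ _ hK mesh r hr M hM hk u hu
    have hq8 : (2 : ℝ) ^ p ≤ 8 := by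
      refine (Real.rpow_le_rpow_of_exponent_le (by norm_num) hp3).trans (le_of_eq ?_)
      rw [show (3 : ℝ) = (3 : ℕ) by norm_num, Real.rpow_natCast]
      norm_num
    exact (lintegral_mono fun ω => SKS.iSup_nrm_le u _ ω).trans
      (hu.lintegral_sup_le hν hL hB hW hr hM hk (by positivity) hq8 hK)
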